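/- Graphs are simple and non-empty, possibly infinite. A \emph{clique} of a graph is a complete subgraph that is maximal with respect to inclusion. A subgraph $Y$ of a connected graph $X$ is \emph{gated} if every vertex $x$ of $X$ has a \emph{gate} $\mathrm{proj}_Y(x) \in Y$, meaning that for every $y \in Y$ some geodesic from $x$ to $y$ passes through $\mathrm{proj}_Y(x)$ (such a gate is unique). A connected graph is \emph{clique-gated} if all its cliques are gated; two of its cliques $C_1,C_2$ are then \emph{parallel} if $\mathrm{proj}_{C_2}$ induces a bijection $C_1 \to C_2$. A \emph{paraclique graph} is a clique-gated graph in which parallelism of cliques is transitive. In a paraclique graph, a \emph{hyperplane} is the union of all the edges of the cliques in a parallelism class; the \emph{sectors} delimited by a hyperplane $J$ are the connected components of the graph obtained by removing the edges in $J$; and two hyperplanes $J,H$ are \emph{transverse} if every sector delimited by $J$ intersects every sector delimited by $H$. A \emph{Hamming graph} is a (weak) Cartesian product of complete graphs, and a \emph{quasi-median graph} is a retract of a Hamming graph (a retraction may collapse edges to vertices); every quasi-median graph is paraclique. An \emph{isometric embedding} is a map between vertex sets that preserves graph distances. \textbf{Proposition.} Let $X$ be a paraclique graph. There exist a quasi-median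 graph $M$ and an isometric embedding $\iota : X \hookrightarrow M$ such that, for every isometric embedding $\eta$ of $X$ into a quasi-median graph $QM$, there is an isometric embedding $\xi : M \hookrightarrow QM$ satisfying $\eta = \xi \circ \iota$. Moreover: \begin{itemize} \item[(i)] if $C$ is a clique of $X$, then $\iota(C)$ is a clique of $M$; \item[(ii)] every clique of $M$ is parallel in $M$ to $\iota(C)$ for some clique $C$ of $X$; \item[(iii)] for any two cliques $C_1,C_2$ of $X$, the cliques $\iota(C_1),\iota(C_2)$ are parallel in $M$ if and only if $C_1,C_2$ are parallel in $X$; \item[(iv)] for any two cliques $C_1,C_2$ of $X$, the hyperplanes of $M$ containing $\iota(C_1)$ and $\iota(C_2)$ are transverse in $M$ if and only if the hyperplanes of $X$ containing $C_1$ and $C_2$ are transverse in $X$. \end{itemize} -/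

import Mathlib

universe u v

namespace Paraclique

/-- A clique, in the sense of an inclusion-maximal complete subgraph (given by its vertices). -/
def IsMaxClique {V : Type u} (G : SimpleGraph V) (C : Set V) : Prop :=
  Maximal G.IsClique C

/-- In a connected graph, `p` is the gate of `x` in `Y`: `p` is a vertex of `Y`, and for every
`y ∈ Y` some geodesic from `x` to `y` passes through `p`. -/
def IsGate {V : Type u} (G : SimpleGraph V) (Y : Set V) (x p : V) : Prop :=
  p ∈ Y ∧ ∀ y ∈ Y, ∃ w : G.Walk x y, w.length = G.dist x y ∧ p ∈ w.support

/-- Every vertex has a gate in `Y`. -/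
def IsGated {V : Type u} (G : SimpleGraph V) (Y : Set V) : Prop :=
  ∀ x : V, ∃ p : V, IsGate G Y x p

/-- Connected graphs all of whose cliques are gated. -/
structure IsCliqueGated {V : Type u} (G : SimpleGraph V) : Prop where
  connected : G.Connected
  gated : ∀ C : Set V, IsMaxClique G C → IsGated G C

/-- The projection to `D` (which sends a vertex to its gate in `D`; gates are unique) induces a
bijection from `C` to `D`. -/
def Parallel {V : Type u} (G : SimpleGraph V) (C D : Set V) : Prop :=
  ∃ f : V → V, (∀ x ∈ C, IsGate G D x (f x)) ∧ Set.BijOn f C D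

/-- Paraclique graphs: clique-gated graphs in which parallelism of cliques is transitive. -/
structure IsParaclique {V : Type u} (G : SimpleGraph V) : Prop extends IsCliqueGated G where
  parallel_trans : ∀ C D E : Set V, IsMaxClique G C → IsMaxClique G D → IsMaxClique G E →
    Parallel G C D → Parallel G D E → Parallel G C E

/-- The hyperplane of the clique `C`: all the edges of the cliques parallel to `C`. -/
def hyperplane {V : Type u} (G : SimpleGraph V) (C : Set V) : Set (Sym2 V) :=
  {e | e ∈ G.edgeSet ∧ ∃ D : Set V, IsMaxClique G D ∧ Parallel G C D ∧ ∀ z ∈ e, z ∈ D}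

/-- The sectors delimited by a set `J` of edges: the (vertex sets of the) connected components of
the graph obtained by removing the edges in `J`. -/
def IsSector {V : Type u} (G : SimpleGraph V) (J : Set (Sym2 V)) (S : Set V) : Prop :=
  ∃ c : (G.deleteEdges J).ConnectedComponent, S = c.supp

/-- Every sector delimited by `J` meets every sector delimited by `H`. -/
def Transverse {V : Type u} (G : SimpleGraph V) (J H : Set (Sym2 V)) : Prop :=
  ∀ S T : Set V, IsSector G J S → IsSector G H T → (S ∩ T).Nonempty

/-- Distance-preserving maps between the vertex sets of (connected) graphs. -/
def IsIsometricEmbedding {V : Type u} {W : Type v} (G : SimpleGraph V) (H : SimpleGraph W)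
    (f : V → W) : Prop :=
  ∀ x y : V, H.dist (f x) (f y) = G.dist x y

/-- The Hamming graph `∏ (K i, o i)`, i.e. the (weak) Cartesian product of the complete graphs on
the sets `K i`: vertices are the families that differ from the base point `o` at finitely many
indices, and two of them are adjacent when they differ at exactly one index. -/
def hammingGraph {I : Type u} (K : I → Type u) (o : ∀ i, K i) :
    SimpleGraph {f : ∀ i, K i // {i | f i ≠ o i}.Finite} where
  Adj f g := ∃ i, f.1 i ≠ g.1 i ∧ ∀ j, j ≠ i → f.1 j = g.1 j
  symm := ⟨fun _ _ ⟨i, hi, h⟩ => ⟨i, hi.symm, fun j hj => (h j hj).symm⟩⟩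
  loopless := ⟨fun _ ⟨_, hi, _⟩ => hi rfl⟩

/-- Quasi-median graphs: retracts of Hamming graphs. As usual in metric graph theory, a retraction
is a 1-Lipschitz map, i.e. it may send the two endpoints of an edge to the same vertex. -/
def IsQuasiMedian {V : Type u} (G : SimpleGraph V) : Prop :=
  ∃ (I : Type u) (K : I → Type u) (o : ∀ i, K i)
    (e : V → {f : ∀ i, K i // {i | f i ≠ o i}.Finite})
    (r : {f : ∀ i, K i // {i | f i ≠ o i}.Finite} → V),
    (∀ x y, G.Adj x y → (hammingGraph K o).Adj (e x) (e y)) ∧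
    (∀ f g, (hammingGraph K o).Adj f g → r f = r g ∨ G.Adj (r f) (r g)) ∧
    ∀ x, r (e x) = x

end Paraclique

/-! Each parallelism class of cliques of `X` gives one coordinate: the gate of a vertex in a
representative clique (`coord`). The projection between two cliques is either constant or bijective,
so an edge changes exactly the coordinate of its own class, and a geodesic crosses each class at
most once. Hence distance in `X` is the number of differing coordinates (`coord_isCoordEmbedding`),
and `X` embeds isometrically in a Hamming graph.

The hull `M` consists of the families that differ from a base vertex at finitely many indices and
whose pairs of coordinates are all realized by vertices of `X`. In the product of any two factors
the image of `X` is everything or a cross (`full_or_cross`). Folding such a product onto the centre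
of its cross never separates neighbours by more than one coordinate. A potential weighted by the
distance from the base vertex to the hyperplanes decreases under folds, so they compose
transfinitely to a retraction onto `M` (`exists_hull_retraction`). Maximal cliques of `M` are lines
in one coordinate direction, which turns the claims on parallelism and transversality into
statements about labels and pairs of coordinates.

For universality, an isometric embedding of `X` in a retract of a Hamming graph assigns one label to
each class, injectively (`label_injective`), and so extends to families of coordinates. The retract
is closed under the dual discriminator (`exists_eq_majority`), and a Baker-Pixley argument
(`mem_of_majority_closed`) shows that a set closed under it and containing the image of `X` contains
every family determined by realized pairs. So `M` lands in the retract. -/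

namespace Paraclique

/-! ### Geodesics, gates and maximal cliques in connected graphs. -/

section Graph

variable {V : Type*} {W : Type*} {G : SimpleGraph V} {H : SimpleGraph W}

theorem isGate_iff (hG : G.Connected) {Y : Set V} {x p : V} :
    IsGate G Y x p ↔ p ∈ Y ∧ ∀ y ∈ Y, G.dist x p + G.dist p y = G.dist x y := by
  classical
  refine and_congr_right fun _ => forall₂_congr fun y _ => ⟨?_, fun h => ?_⟩
  · rintro ⟨w, hw, hp⟩
    refine le_antisymm ?_ hG.dist_triangle
    rw [← hw, ← congrArg SimpleGraph.Walk.length (w.take_spec hp), SimpleGraph.Walk.length_append]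
    exact add_le_add (SimpleGraph.dist_le _) (SimpleGraph.dist_le _)
  · obtain ⟨w₁, h₁⟩ := hG.exists_walk_length_eq_dist x p
    obtain ⟨w₂, h₂⟩ := hG.exists_walk_length_eq_dist p y
    refine ⟨w₁.append w₂, ?_, ?_⟩
    · rw [SimpleGraph.Walk.length_append, h₁, h₂, h]
    · simp [SimpleGraph.Walk.mem_support_append_iff]

theorem exists_adj_dist (hG : G.Connected) {x y : V} (h : x ≠ y) :
    ∃ z, G.Adj x z ∧ G.dist z y + 1 = G.dist x y := by
  obtain ⟨w, hw⟩ := hG.exists_walk_length_eq_dist x y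
  cases w with
  | nil => exact absurd rfl h
  | @cons _ z _ hz w =>
    refine ⟨z, hz, ?_⟩
    have h1 := SimpleGraph.dist_le w
    have h2 := hG.dist_triangle (u := x) (v := z) (w := y)
    have h3 := SimpleGraph.dist_eq_one_iff_adj.2 hz
    simp only [SimpleGraph.Walk.length_cons] at hw
    omega

/-- A function with distinct values at two vertices changes along an edge of some geodesic. -/
theorem exists_crossing {α : Type*} (hG : G.Connected) (c : V → α) {x y : V} (h : c x ≠ c y) :
    ∃ u v, G.Adj u v ∧ c u ≠ c v ∧ G.dist x u + 1 + G.dist v y = G.dist x y := by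
  induction hn : G.dist x y generalizing x with
  | zero =>
    obtain rfl := hG.dist_eq_zero_iff.1 hn
    exact absurd rfl h
  | succ n ih =>
    obtain ⟨z, hz, hd⟩ := exists_adj_dist hG (x := x) (y := y) (by rintro rfl; exact h rfl)
    by_cases hc : c x = c z
    · obtain ⟨u, v, huv, hne, hd'⟩ := ih (x := z) (hc ▸ h) (by omega)
      refine ⟨u, v, huv, hne, ?_⟩
      have h1 := hG.dist_triangle (u := x) (v := z) (w := u)
      have h2 := SimpleGraph.dist_eq_one_iff_adj.2 hz
      have h3 := hG.dist_triangle (u := x) (v := u) (w := y)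
      have h4 := hG.dist_triangle (u := u) (v := v) (w := y)
      have h5 := SimpleGraph.dist_eq_one_iff_adj.2 huv
      omega
    · exact ⟨x, z, hz, hc, by simp; omega⟩

theorem exists_walk_map {φ : V → W} (hφ : ∀ x y, G.Adj x y → φ x = φ y ∨ H.Adj (φ x) (φ y))
    {x y : V} (w : G.Walk x y) : ∃ w' : H.Walk (φ x) (φ y), w'.length ≤ w.length := by
  induction w with
  | nil => exact ⟨.nil, le_rfl⟩
  | cons h w ih =>
    obtain ⟨w', hw'⟩ := ih
    rcases hφ _ _ h with h | h
    · exact ⟨w'.copy h.symm rfl, by simp; omega⟩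
    · exact ⟨.cons h w', by simpa using hw'⟩

theorem dist_map_le (hG : G.Connected) {φ : V → W}
    (hφ : ∀ x y, G.Adj x y → φ x = φ y ∨ H.Adj (φ x) (φ y)) (x y : V) :
    H.dist (φ x) (φ y) ≤ G.dist x y := by
  obtain ⟨w, hw⟩ := hG.exists_walk_length_eq_dist x y
  obtain ⟨w', hw'⟩ := exists_walk_map hφ w
  exact (SimpleGraph.dist_le w').trans (hw ▸ hw')

theorem connected_of_retraction (hH : H.Connected) {r : W → V} {e : V → W}
    (hr : ∀ f g, H.Adj f g → r f = r g ∨ G.Adj (r f) (r g)) (hre : ∀ x, r (e x) = x) :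
    G.Connected := by
  have : Nonempty V := hH.nonempty.map r
  refine ⟨fun x y => ?_⟩
  obtain ⟨w⟩ := hH.preconnected (e x) (e y)
  obtain ⟨w', -⟩ := exists_walk_map hr w
  rw [hre, hre] at w'
  exact ⟨w'⟩

theorem dist_eq_of_retraction (hH : H.Connected) {r : W → V} {e : V → W}
    (he : ∀ x y, G.Adj x y → H.Adj (e x) (e y))
    (hr : ∀ f g, H.Adj f g → r f = r g ∨ G.Adj (r f) (r g)) (hre : ∀ x, r (e x) = x) (x y : V) :
    H.dist (e x) (e y) = G.dist x y := by
  refine le_antisymm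
    (dist_map_le (connected_of_retraction hH hr hre) (fun x y h => Or.inr (he x y h)) x y) ?_
  simpa only [hre] using dist_map_le hH hr (e x) (e y)

theorem exists_isMaxClique_of_isClique {A : Set V} (hA : G.IsClique A) :
    ∃ C, IsMaxClique G C ∧ A ⊆ C := by
  obtain ⟨C, hAC, hC⟩ := zorn_subset_nonempty {C | G.IsClique C} (fun c hc hchain _ =>
    ⟨⋃₀ c, (Set.pairwise_sUnion hchain.directedOn).2 fun s hs => hc hs,
      fun s hs => Set.subset_sUnion_of_mem hs⟩) A hA
  exact ⟨C, hC, hAC⟩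

theorem exists_isMaxClique_of_adj {x y : V} (h : G.Adj x y) :
    ∃ C, IsMaxClique G C ∧ x ∈ C ∧ y ∈ C := by
  obtain ⟨C, hC, hs⟩ := exists_isMaxClique_of_isClique (G := G) (A := {x, y})
    (by simp [h])
  exact ⟨C, hC, hs (by simp), hs (by simp)⟩

theorem IsMaxClique.eq_of_subset {C D : Set V} (hC : IsMaxClique G C) (hD : G.IsClique D)
    (h : C ⊆ D) : C = D :=
  h.antisymm (hC.2 hD h)

theorem IsMaxClique.nonempty [Nonempty V] {C : Set V} (hC : IsMaxClique G C) : C.Nonempty := by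
  by_contra h
  rw [Set.not_nonempty_iff_eq_empty] at h
  subst h
  have x := Classical.arbitrary V
  have := hC.eq_of_subset (D := {x}) (by simp) (by simp)
  simp at this

theorem IsMaxClique.nontrivial [Nontrivial V] (hG : G.Connected) {C : Set V}
    (hC : IsMaxClique G C) : C.Nontrivial := by
  obtain ⟨x, hx⟩ := hC.nonempty
  obtain ⟨y, hy⟩ := exists_ne x
  obtain ⟨z, hz, -⟩ := exists_adj_dist hG hy.symm
  by_contra h
  rw [Set.not_nontrivial_iff] at h
  have hCx : C = {x} := h.eq_singleton_of_mem hx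
  have := hC.eq_of_subset (D := {x, z}) (by simp [hz]) (by simp [hCx])
  rw [hCx] at this
  have hz' : z ∈ ({x} : Set V) := this ▸ by simp
  exact hz.ne hz'.symm

theorem IsGate.unique (hG : G.Connected) {Y : Set V} {x p q : V} (hp : IsGate G Y x p)
    (hq : IsGate G Y x q) : p = q := by
  rw [isGate_iff hG] at hp hq
  have h1 := hp.2 q hq.1
  have h2 := hq.2 p hp.1
  exact hG.dist_eq_zero_iff.1 (by omega)

theorem isGate_self {Y : Set V} {x : V} (hx : x ∈ Y) (hG : G.Connected) : IsGate G Y x x :=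
  (isGate_iff hG).2 ⟨hx, by simp⟩

theorem parallel_iff (hG : G.Connected) {C D : Set V} {f : V → V}
    (hf : ∀ x ∈ C, IsGate G D x (f x)) : Parallel G C D ↔ Set.BijOn f C D := by
  refine ⟨?_, fun h => ⟨f, hf, h⟩⟩
  rintro ⟨g, hg, hb⟩
  exact hb.congr fun x hx => (hg x hx).unique hG (hf x hx)

theorem Parallel.refl (hG : G.Connected) (C : Set V) : Parallel G C C :=
  ⟨id, fun _ hx => isGate_self hx hG, Set.bijOn_id C⟩

end Graph

/-! ### Isometric coordinates with values in a Hamming metric. -/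

section Coordinates

variable {V : Type*} {I : Type*} {K : I → Type*}

/-- The coordinates `c` embed the graph metric of `G` into the Hamming metric. -/
def IsCoordEmbedding (G : SimpleGraph V) (c : V → ∀ i, K i) : Prop :=
  ∀ x y, {i | c x i ≠ c y i}.encard = G.dist x y

variable {G : SimpleGraph V} {c : V → ∀ i, K i}

/-- The difference set of `x, y` lies in the union of those of `x, z` and `z, y`. Distances add up
exactly when these two are disjoint, and then their union is the difference set of `x, y`. -/
theorem IsCoordEmbedding.between_iff (hc : IsCoordEmbedding G c) {x y z : V} :
    G.dist x z + G.dist z y = G.dist x y ↔ ∀ i, c z i = c x i ∨ c z i = c y i := by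
  have hu := Set.encard_union_add_encard_inter {i | c x i ≠ c z i} {i | c z i ≠ c y i}
  have hsub : {i | c x i ≠ c y i} ⊆ {i | c x i ≠ c z i} ∪ {i | c z i ≠ c y i} := by
    intro i hi
    by_contra h
    simp only [Set.mem_union, Set.mem_ofPred_eq, not_or, not_not] at h
    exact hi (h.1.trans h.2)
  rw [hc, hc] at hu
  constructor
  · intro h i
    have h1 := Set.encard_le_encard hsub
    rw [hc] at h1
    have h2 : ({i | c x i ≠ c z i} ∩ {i | c z i ≠ c y i}).encard = 0 := by
      rw [← Nat.cast_add, h] at hu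
      have h3 : (G.dist x y : ℕ∞) + ({i | c x i ≠ c z i} ∩ {i | c z i ≠ c y i}).encard
          ≤ (G.dist x y : ℕ∞) + 0 := by
        rw [add_zero, ← hu]
        gcongr
        simpa [hu] using h1
      exact nonpos_iff_eq_zero.1 ((ENat.add_le_add_iff_left (ENat.natCast_ne_top _)).1 h3)
    rw [Set.encard_eq_zero] at h2
    by_contra h3
    push Not at h3
    have : i ∈ ({i | c x i ≠ c z i} ∩ {i | c z i ≠ c y i}) := ⟨h3.1.symm, h3.2⟩
    simp [h2] at this
  · intro h
    have h1 : {i | c x i ≠ c z i} ∩ {i | c z i ≠ c y i} = ∅ := by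
      ext i
      simp only [Set.mem_inter_iff, Set.mem_ofPred_eq, Set.mem_empty_iff_false, iff_false, not_and,
        not_not]
      intro hi
      exact (h i).resolve_left (Ne.symm hi)
    have h2 : {i | c x i ≠ c z i} ∪ {i | c z i ≠ c y i} = {i | c x i ≠ c y i} := by
      refine (Set.union_subset ?_ ?_).antisymm hsub
      · intro i hi
        exact fun h' => hi ((h i).elim Eq.symm fun h'' => h'.trans h''.symm)
      · intro i hi
        exact fun h' => hi ((h i).elim (fun h'' => h''.trans h') id)
    rw [h1, h2, hc, Set.encard_empty, add_zero] at hu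
    exact_mod_cast hu.symm

theorem IsCoordEmbedding.adj_iff (hc : IsCoordEmbedding G c) {x y : V} :
    G.Adj x y ↔ ∃ i, c x i ≠ c y i ∧ ∀ j, j ≠ i → c x j = c y j := by
  rw [← SimpleGraph.dist_eq_one_iff_adj, ← ENat.natCast_inj, ← hc, Nat.cast_one, Set.encard_eq_one]
  refine exists_congr fun i => ?_
  rw [Set.eq_singleton_iff_unique_mem]
  refine and_congr_right fun _ => forall_congr' fun j => ?_
  simp only [Set.mem_ofPred_eq]
  tauto

theorem IsCoordEmbedding.label_unique (hc : IsCoordEmbedding G c) {x y : V} (h : G.Adj x y)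
    {i j : I} (hi : c x i ≠ c y i) (hj : c x j ≠ c y j) : i = j := by
  obtain ⟨k, -, hk⟩ := hc.adj_iff.1 h
  rw [not_imp_comm.1 (hk i) hi, not_imp_comm.1 (hk j) hj]

theorem IsCoordEmbedding.injective (hG : G.Connected) (hc : IsCoordEmbedding G c) :
    Function.Injective c := by
  intro x y h
  have := hc x y
  simp only [h, ne_eq, not_true_eq_false, Set.ofPred_false, Set.encard_empty] at this
  exact hG.dist_eq_zero_iff.1 (by exact_mod_cast this.symm)

/-- A coordinate that changes along an edge of a geodesic is constant before and after it. -/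
theorem IsCoordEmbedding.eq_of_crossing (hG : G.Connected) (hc : IsCoordEmbedding G c)
    {x y u v : V} (huv : G.Adj u v) (hd : G.dist x u + 1 + G.dist v y = G.dist x y) {i : I}
    (hi : c u i ≠ c v i) : c u i = c x i ∧ c v i = c y i := by
  have h1 := SimpleGraph.dist_eq_one_iff_adj.2 huv
  have h2 := hG.dist_triangle (u := x) (v := v) (w := y)
  have h3 := hG.dist_triangle (u := x) (v := u) (w := v)
  have h4 := hG.dist_triangle (u := x) (v := u) (w := y)
  have h5 := hG.dist_triangle (u := u) (v := v) (w := y)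
  have h6 := (hc.between_iff (x := x) (z := u) (y := v)).1 (by omega) i
  have h7 := (hc.between_iff (x := u) (z := v) (y := y)).1 (by omega) i
  exact ⟨h6.resolve_right hi, h7.resolve_left hi.symm⟩

theorem between_left_of_crossing (hG : G.Connected) {x y u v : V} (huv : G.Adj u v)
    (hd : G.dist x u + 1 + G.dist v y = G.dist x y) : G.dist x u + G.dist u y = G.dist x y := by
  have h1 := SimpleGraph.dist_eq_one_iff_adj.2 huv
  have h4 := hG.dist_triangle (u := x) (v := u) (w := y)
  have h5 := hG.dist_triangle (u := u) (v := v) (w := y)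
  omega

/-- The edges along which the `i`-th coordinate changes. -/
def labelEdges (G : SimpleGraph V) (c : V → ∀ i, K i) (i : I) : Set (Sym2 V) :=
  {e | e ∈ G.edgeSet ∧ ∃ x ∈ e, ∃ y ∈ e, c x i ≠ c y i}

theorem mk_mem_labelEdges {x y : V} {i : I} :
    s(x, y) ∈ labelEdges G c i ↔ G.Adj x y ∧ c x i ≠ c y i := by
  simp only [labelEdges, Set.mem_ofPred_eq, SimpleGraph.mem_edgeSet, Sym2.mem_iff]
  refine and_congr_right fun _ => ⟨?_, fun h => ⟨x, .inl rfl, y, .inr rfl, h⟩⟩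
  rintro ⟨a, rfl | rfl, b, rfl | rfl, h⟩
  exacts [absurd rfl h, h, h.symm, absurd rfl h]

/-- If the endpoints share the `i`-th coordinate, a geodesic between them never changes it, by
`between_iff`, and so avoids the deleted edges. Sectors are therefore the fibres of a coordinate. -/
theorem IsCoordEmbedding.reachable_deleteEdges_iff (hG : G.Connected) (hc : IsCoordEmbedding G c)
    {i : I} {x y : V} : (G.deleteEdges (labelEdges G c i)).Reachable x y ↔ c x i = c y i := by
  constructor
  · rintro ⟨w⟩
    induction w with
    | nil => rfl
    | cons h _ ih =>
      rw [SimpleGraph.deleteEdges_adj, mk_mem_labelEdges] at h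
      exact (not_not.1 fun h' => h.2 ⟨h.1, h'⟩).trans ih
  · intro h
    induction hn : G.dist x y generalizing x with
    | zero => rw [hG.dist_eq_zero_iff.1 hn]
    | succ n ih =>
      obtain ⟨z, hz, hd⟩ := exists_adj_dist hG (x := x) (y := y) (by rintro rfl; simp at hn)
      have h1 := SimpleGraph.dist_eq_one_iff_adj.2 hz
      have h2 := (hc.between_iff (x := x) (z := z) (y := y)).1 (by omega) i
      rw [← h, or_self] at h2
      refine .trans (SimpleGraph.Adj.reachable ?_) (ih (h2.trans h) (by omega))
      rw [SimpleGraph.deleteEdges_adj, mk_mem_labelEdges]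
      exact ⟨hz, fun h' => h'.2 h2.symm⟩

theorem IsCoordEmbedding.isSector_iff (hG : G.Connected) (hc : IsCoordEmbedding G c) {i : I}
    {S : Set V} : IsSector G (labelEdges G c i) S ↔ ∃ x, S = {y | c y i = c x i} := by
  have key : ∀ x, ((G.deleteEdges (labelEdges G c i)).connectedComponentMk x).supp
      = {y | c y i = c x i} := by
    intro x
    ext y
    rw [SimpleGraph.ConnectedComponent.mem_supp_iff, SimpleGraph.ConnectedComponent.eq,
      hc.reachable_deleteEdges_iff hG, Set.mem_ofPred_eq]
  constructor
  · rintro ⟨C, rfl⟩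
    induction C using SimpleGraph.ConnectedComponent.ind with
    | h x => exact ⟨x, key x⟩
  · rintro ⟨x, rfl⟩
    exact ⟨_, (key x).symm⟩

theorem IsCoordEmbedding.transverse_iff (hG : G.Connected) (hc : IsCoordEmbedding G c) {i j : I} :
    Transverse G (labelEdges G c i) (labelEdges G c j) ↔
      ∀ x y, ∃ z, c z i = c x i ∧ c z j = c y j := by
  constructor
  · intro h x y
    exact h _ _ ((hc.isSector_iff hG).2 ⟨x, rfl⟩) ((hc.isSector_iff hG).2 ⟨y, rfl⟩)
  · intro h S T hS hT
    obtain ⟨x, rfl⟩ := (hc.isSector_iff hG).1 hS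
    obtain ⟨y, rfl⟩ := (hc.isSector_iff hG).1 hT
    exact h x y

theorem IsCoordEmbedding.hyperplane_eq (hc : IsCoordEmbedding G c) {C : Set V} {i : I}
    {L : Set V → I} (hL : ∀ D, IsMaxClique G D → ∀ x ∈ D, ∀ y ∈ D, x ≠ y → c x (L D) ≠ c y (L D))
    (hC : ∀ D, IsMaxClique G D → (Parallel G C D ↔ L D = i)) :
    hyperplane G C = labelEdges G c i := by
  ext e
  induction e using Sym2.ind with
  | h x y =>
    rw [mk_mem_labelEdges]
    simp only [hyperplane, Set.mem_ofPred_eq, SimpleGraph.mem_edgeSet, Sym2.mem_iff, forall_eq_or_imp,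
      forall_eq]
    refine and_congr_right fun hxy => ⟨?_, fun h => ?_⟩
    · rintro ⟨D, hD, hp, hx, hy⟩
      exact (hC D hD).1 hp ▸ hL D hD x hx y hy hxy.ne
    · obtain ⟨D, hD, hx, hy⟩ := exists_isMaxClique_of_adj hxy
      exact ⟨D, hD, (hC D hD).2 (hc.label_unique hxy (hL D hD x hx y hy hxy.ne) h), hx, hy⟩

end Coordinates

/-! ### The metric of a Hamming graph. -/

section Hamming

variable {I : Type u} {K : I → Type u} {o : ∀ i, K i}

theorem finite_ne (f g : {f : ∀ i, K i // {i | f i ≠ o i}.Finite}) :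
    {i | f.1 i ≠ g.1 i}.Finite := by
  refine (f.2.union g.2).subset fun i hi => ?_
  by_contra h
  simp only [Set.mem_union, Set.mem_ofPred_eq, not_or, not_not] at h
  exact hi (h.1.trans h.2.symm)

theorem hammingGraph_adj {f g : {f : ∀ i, K i // {i | f i ≠ o i}.Finite}} :
    (hammingGraph K o).Adj f g ↔ ∃ i, f.1 i ≠ g.1 i ∧ ∀ j, j ≠ i → f.1 j = g.1 j :=
  Iff.rfl

theorem hammingGraph_encard_le_length {f g : {f : ∀ i, K i // {i | f i ≠ o i}.Finite}}
    (w : (hammingGraph K o).Walk f g) : {i | f.1 i ≠ g.1 i}.encard ≤ w.length := by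
  induction w with
  | nil => simp
  | @cons f g h hfg w ih =>
    rw [SimpleGraph.Walk.length_cons, Nat.cast_add, Nat.cast_one]
    obtain ⟨i, -, hi⟩ := hammingGraph_adj.1 hfg
    calc {j | f.1 j ≠ h.1 j}.encard ≤ (insert i {j | g.1 j ≠ h.1 j}).encard := by
          refine Set.encard_le_encard fun j hj => ?_
          by_cases hji : j = i
          · exact .inl hji
          · exact .inr fun h' => hj ((hi j hji).trans h')
      _ ≤ {j | g.1 j ≠ h.1 j}.encard + 1 := Set.encard_insert_le _ _
      _ ≤ _ := by gcongr

theorem hammingGraph_exists_walk {n : ℕ} {f g : {f : ∀ i, K i // {i | f i ≠ o i}.Finite}}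
    (h : {i | f.1 i ≠ g.1 i}.encard = n) :
    ∃ w : (hammingGraph K o).Walk f g, w.length = n := by
  classical
  induction n generalizing f with
  | zero =>
    rw [Nat.cast_zero, Set.encard_eq_zero] at h
    obtain rfl : f = g := by
      ext i
      by_contra hi
      exact (h ▸ hi : i ∈ (∅ : Set I))
    exact ⟨.nil, rfl⟩
  | succ n ih =>
    obtain ⟨i, hi⟩ : {i | f.1 i ≠ g.1 i}.Nonempty := by
      rw [← Set.encard_ne_zero, h]
      exact_mod_cast n.succ_ne_zero
    let f' : {f : ∀ i, K i // {i | f i ≠ o i}.Finite} := ⟨Function.update f.1 i (g.1 i), by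
      refine (f.2.insert i).subset fun j hj => ?_
      by_cases hji : j = i
      · exact .inl hji
      · exact .inr (by simpa [hji] using hj)⟩
    have hf' : {j | f'.1 j ≠ g.1 j} = {j | f.1 j ≠ g.1 j} \ {i} := by
      ext j
      by_cases hji : j = i
      · subst hji; simp [f']
      · simp [f', hji]
    obtain ⟨w, hw⟩ := ih (f := f') (by
      have := Set.encard_sdiff_singleton_add_one hi
      rw [h, ← hf', Nat.cast_add, Nat.cast_one] at this
      exact WithTop.add_right_cancel ENat.one_ne_top this)
    have hadj : (hammingGraph K o).Adj f f' :=
      hammingGraph_adj.2 ⟨i, by simpa [f'] using hi, fun j hj => by simp [f', hj]⟩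
    exact ⟨.cons hadj w, by rw [SimpleGraph.Walk.length_cons, hw]⟩

theorem hammingGraph_connected (K : I → Type u) (o : ∀ i, K i) :
    (hammingGraph K o).Connected := by
  have : Nonempty {f : ∀ i, K i // {i | f i ≠ o i}.Finite} := ⟨⟨o, by simp⟩⟩
  refine ⟨fun f g => ?_⟩
  obtain ⟨w, -⟩ := hammingGraph_exists_walk (finite_ne f g).cast_ncard_eq.symm
  exact ⟨w⟩

theorem hammingGraph_isCoordEmbedding (K : I → Type u) (o : ∀ i, K i) :
    IsCoordEmbedding (hammingGraph K o) Subtype.val := by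
  intro f g
  have h := (finite_ne f g).cast_ncard_eq.symm
  obtain ⟨w, hw⟩ := hammingGraph_exists_walk h
  obtain ⟨w', hw'⟩ := (hammingGraph_connected K o).exists_walk_length_eq_dist f g
  refine le_antisymm (hw' ▸ hammingGraph_encard_le_length w') ?_
  rw [h, ← hw]
  exact_mod_cast SimpleGraph.dist_le w

end Hamming

end Paraclique

namespace Paraclique

/-! ### Projections between cliques of a clique-gated graph. -/

section CliqueGated

variable {V : Type*} {G : SimpleGraph V}

theorem IsGate.dist_eq_add_one (hG : G.Connected) {D : Set V} (hD : IsMaxClique G D) {x p y : V}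
    (hp : IsGate G D x p) (hy : y ∈ D) (hne : y ≠ p) : G.dist x y = G.dist x p + 1 := by
  rw [isGate_iff hG] at hp
  rw [← hp.2 y hy, SimpleGraph.dist_eq_one_iff_adj.2 (hD.1 hp.1 hy hne.symm)]

/-- On a clique the distance to `x` is minimal at the gate and exactly one more everywhere else. -/
theorem IsCliqueGated.isGate_of_dist_lt (hG : IsCliqueGated G) {D : Set V} (hD : IsMaxClique G D)
    {x p q : V} (hp : p ∈ D) (hq : q ∈ D) (h : G.dist x p < G.dist x q) : IsGate G D x p := by
  obtain ⟨r, hr⟩ := hG.gated D hD x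
  by_cases hpr : p = r
  · exact hpr ▸ hr
  · have h1 := hr.dist_eq_add_one hG.connected hD hp hpr
    have h2 : G.dist x q ≤ G.dist x r + 1 := by
      by_cases hqr : q = r
      · rw [hqr]; omega
      · exact (hr.dist_eq_add_one hG.connected hD hq hqr).le
    omega

/-- Since `p ≠ q`, the distance from `x` to `q` exceeds that to `p` by one, and the distance from
`y` to `p` exceeds that to `q` by one. As `x` and `y` are adjacent, `p` is strictly closer to `x`
than to `y`. -/
theorem IsCliqueGated.isGate_symm (hG : IsCliqueGated G) {C D : Set V} (hC : IsMaxClique G C)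
    (hD : IsMaxClique G D) {x y p q : V} (hx : x ∈ C) (hy : y ∈ C) (hp : IsGate G D x p)
    (hq : IsGate G D y q) (hpq : p ≠ q) : IsGate G C p x := by
  have hxy : x ≠ y := by
    rintro rfl
    exact hpq (hp.unique hG.connected hq)
  refine hG.isGate_of_dist_lt hC hx hy ?_
  rw [G.dist_comm, G.dist_comm (u := p)]
  have h1 := hp.dist_eq_add_one hG.connected hD hq.1 hpq.symm
  have h2 := hq.dist_eq_add_one hG.connected hD hp.1 hpq
  have h3 := hG.connected.dist_triangle (u := x) (v := y) (w := q)
  have h4 := SimpleGraph.dist_eq_one_iff_adj.2 (hC.1 hx hy hxy)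
  omega

/-- A projection that is not constant is a bijection: every gate differs from one of `p`, `q`, so
`isGate_symm` makes projecting back an inverse on both sides. -/
theorem IsCliqueGated.parallel_of_ne (hG : IsCliqueGated G) {C D : Set V} (hC : IsMaxClique G C)
    (hD : IsMaxClique G D) {x y p q : V} (hx : x ∈ C) (hy : y ∈ C) (hp : IsGate G D x p)
    (hq : IsGate G D y q) (hpq : p ≠ q) : Parallel G C D := by
  choose f hf using hG.gated D hD
  refine ⟨f, fun x _ => hf x, fun x _ => (hf x).1, ?_, ?_⟩
  · intro z hz w hw hzw
    have hgz := hf z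
    have hgw := hf w
    rw [← hzw] at hgw
    by_cases h : p = f z
    · have h' : q ≠ f z := fun h' => hpq (h.trans h'.symm)
      exact (hG.isGate_symm hC hD hz hy hgz hq h'.symm).unique hG.connected
        (hG.isGate_symm hC hD hw hy hgw hq h'.symm)
    · exact (hG.isGate_symm hC hD hz hx hgz hp (Ne.symm h)).unique hG.connected
        (hG.isGate_symm hC hD hw hx hgw hp (Ne.symm h))
  · intro s hs
    have hxy : x ≠ y := by
      rintro rfl
      exact hpq (hp.unique hG.connected hq)
    obtain ⟨t, ht⟩ := hG.gated C hC s
    have hpx := hG.isGate_symm hC hD hx hy hp hq hpq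
    have hqy := hG.isGate_symm hC hD hy hx hq hp hpq.symm
    refine ⟨t, ht.1, (hf t).unique hG.connected ?_⟩
    by_cases h : t = x
    · exact hG.isGate_symm hD hC hs hq.1 ht hqy (h ▸ hxy)
    · exact hG.isGate_symm hD hC hs hp.1 ht hpx h

theorem Parallel.gate_injOn (hG : G.Connected) {C D : Set V} (h : Parallel G C D) {x y p : V}
    (hx : x ∈ C) (hy : y ∈ C) (hp : IsGate G D x p) (hq : IsGate G D y p) : x = y := by
  obtain ⟨f, hf, hb⟩ := h
  exact hb.injOn hx hy (((hf x hx).unique hG hp).trans ((hf y hy).unique hG hq).symm)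

theorem IsCliqueGated.parallel_symm (hG : IsCliqueGated G) {C D : Set V} (hC : IsMaxClique G C)
    (hD : IsMaxClique G D) (h : Parallel G C D) : Parallel G D C := by
  have := hG.connected.nonempty
  rcases subsingleton_or_nontrivial V with hV | hV
  · rw [hC.nonempty.eq_univ, hD.nonempty.eq_univ]
    exact Parallel.refl hG.connected _
  · obtain ⟨x, hx, y, hy, hxy⟩ := hC.nontrivial hG.connected
    obtain ⟨p, hp⟩ := hG.gated D hD x
    obtain ⟨q, hq⟩ := hG.gated D hD y
    have hpq : p ≠ q := by
      rintro rfl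
      exact hxy (h.gate_injOn hG.connected hx hy hp hq)
    exact hG.parallel_of_ne hD hC hp.1 hq.1 (hG.isGate_symm hC hD hx hy hp hq hpq)
      (hG.isGate_symm hC hD hy hx hq hp hpq.symm) hxy

end CliqueGated

/-! ### The gate coordinates of a paraclique graph. -/

section Coord

variable {V : Type u} {X : SimpleGraph V}

/-- Parallelism of the cliques of a paraclique graph. -/
def parallelSetoid (hX : IsParaclique X) : Setoid {C : Set V // IsMaxClique X C} where
  r C D := Parallel X C.1 D.1
  iseqv :=
    { refl := fun C => Parallel.refl hX.connected C.1
      symm := fun {C D} h => hX.parallel_symm C.2 D.2 h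
      trans := fun {C D E} h h' => hX.parallel_trans _ _ _ C.2 D.2 E.2 h h' }

/-- The parallelism classes of cliques. -/
def ParallelClass (hX : IsParaclique X) : Type u := Quotient (parallelSetoid hX)

/-- The parallelism class of a clique. -/
def parallelClass (hX : IsParaclique X) {C : Set V} (hC : IsMaxClique X C) : ParallelClass hX :=
  Quotient.mk (parallelSetoid hX) ⟨C, hC⟩

/-- A clique representing a parallelism class. -/
noncomputable def repClique {hX : IsParaclique X} (i : ParallelClass hX) : Set V :=
  (Quotient.out (s := parallelSetoid hX) i).1

theorem repClique_isMaxClique {hX : IsParaclique X} (i : ParallelClass hX) :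
    IsMaxClique X (repClique i) :=
  (Quotient.out (s := parallelSetoid hX) i).2

theorem parallelClass_eq_iff {hX : IsParaclique X} {C D : Set V} {hC : IsMaxClique X C}
    {hD : IsMaxClique X D} : parallelClass hX hC = parallelClass hX hD ↔ Parallel X C D :=
  Quotient.eq (r := parallelSetoid hX)

theorem parallelClass_repClique {hX : IsParaclique X} (i : ParallelClass hX) :
    parallelClass hX (repClique_isMaxClique i) = i :=
  Quotient.out_eq (s := parallelSetoid hX) i

/-- The coordinates of a vertex: its gates in the representatives of the parallelism classes. -/
noncomputable def coord (hX : IsParaclique X) (x : V) (i : ParallelClass hX) : V :=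
  (hX.gated _ (repClique_isMaxClique i) x).choose

variable {hX : IsParaclique X}

theorem coord_isGate (x : V) (i : ParallelClass hX) : IsGate X (repClique i) x (coord hX x i) :=
  (hX.gated _ (repClique_isMaxClique i) x).choose_spec

theorem coord_mem (x : V) (i : ParallelClass hX) : coord hX x i ∈ repClique i :=
  (coord_isGate x i).1

theorem coord_of_mem {a : V} {i : ParallelClass hX} (ha : a ∈ repClique i) : coord hX a i = a :=
  (coord_isGate a i).unique hX.connected (isGate_self ha hX.connected)

theorem coord_ne_iff {C : Set V} (hC : IsMaxClique X C) {x y : V} (hx : x ∈ C) (hy : y ∈ C)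
    (hxy : x ≠ y) {i : ParallelClass hX} :
    coord hX x i ≠ coord hX y i ↔ parallelClass hX hC = i := by
  rw [← parallelClass_repClique i, parallelClass_eq_iff, parallelClass_repClique i]
  refine ⟨fun h => hX.parallel_of_ne hC (repClique_isMaxClique i) hx hy (coord_isGate x i)
    (coord_isGate y i) h, fun h h' => hxy ?_⟩
  exact h.gate_injOn hX.connected hx hy (coord_isGate x i) (h' ▸ coord_isGate y i)

theorem exists_coord_eq {C : Set V} (hC : IsMaxClique X C) {s : V}
    (hs : s ∈ repClique (parallelClass hX hC)) : ∃ z ∈ C, coord hX z (parallelClass hX hC) = s := by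
  have h : Parallel X C (repClique (parallelClass hX hC)) := by
    rw [← parallelClass_eq_iff (hX := hX) (hC := hC) (hD := repClique_isMaxClique _),
      parallelClass_repClique]
  rw [parallel_iff hX.connected fun x _ => coord_isGate x _] at h
  exact h.surjOn hs

/-- The first edge `xz` of a geodesic to `y` changes only the coordinate of its clique `C`. If `z`
and `y` differed there, a geodesic from `z` to `y` would cross an edge `uv` of a clique `D` parallel
to `C`. Then `u` would be closer than `v` to both `x` and `z`, hence their common gate in `D`,
against injectivity of the projection. -/
theorem coord_isCoordEmbedding (hX : IsParaclique X) : IsCoordEmbedding X (coord hX) := by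
  intro x y
  induction hn : X.dist x y generalizing x with
  | zero => simp [hX.connected.dist_eq_zero_iff.1 hn]
  | succ n ih =>
    obtain ⟨z, hxz, hd⟩ := exists_adj_dist hX.connected (x := x) (y := y)
      (by rintro rfl; simp at hn)
    obtain ⟨C, hC, hxC, hzC⟩ := exists_isMaxClique_of_adj hxz
    have hz : coord hX z (parallelClass hX hC) = coord hX y (parallelClass hX hC) := by
      by_contra h
      obtain ⟨u, v, huv, hne, huvd⟩ := exists_crossing hX.connected
        (fun w => coord hX w (parallelClass hX hC)) h
      obtain ⟨D, hD, huD, hvD⟩ := exists_isMaxClique_of_adj huv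
      have hpar := parallelClass_eq_iff.1 ((coord_ne_iff hD huD hvD huv.ne).1 hne)
      have h1 := SimpleGraph.dist_eq_one_iff_adj.2 hxz
      have h2 := SimpleGraph.dist_eq_one_iff_adj.2 huv
      have h3 := hX.connected.dist_triangle (u := x) (v := z) (w := u)
      have h4 := hX.connected.dist_triangle (u := z) (v := u) (w := v)
      have h5 := hX.connected.dist_triangle (u := x) (v := v) (w := y)
      have h6 := hX.connected.dist_triangle (u := z) (v := v) (w := y)
      have hgx : IsGate X D x u := hX.isGate_of_dist_lt hD huD hvD (by omega)
      have hgz : IsGate X D z u := hX.isGate_of_dist_lt hD huD hvD (by omega)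
      exact hxz.ne ((hX.parallel_symm hD hC hpar).gate_injOn hX.connected hxC hzC hgx hgz)
    have hset : {i | coord hX x i ≠ coord hX y i}
        = insert (parallelClass hX hC) {i | coord hX z i ≠ coord hX y i} := by
      ext i
      by_cases hi : parallelClass hX hC = i
      · subst hi
        simp only [Set.mem_ofPred_eq, Set.mem_insert_iff, true_or, iff_true]
        rw [← hz]
        exact (coord_ne_iff hC hxC hzC hxz.ne).2 rfl
      · have := mt (coord_ne_iff hC hxC hzC hxz.ne).1 hi
        rw [not_not] at this
        simp [this, Ne.symm hi]
    rw [hset, Set.encard_insert_of_notMem (by simpa using hz), ih z (by omega)]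
    push_cast
    rfl

theorem coord_eq_of_mem_repClique {i j : ParallelClass hX} (hij : i ≠ j) {x y : V}
    (hx : x ∈ repClique i) (hy : y ∈ repClique i) : coord hX x j = coord hX y j := by
  by_cases hxy : x = y
  · rw [hxy]
  · by_contra h
    exact hij ((parallelClass_repClique i).symm.trans
      ((coord_ne_iff (repClique_isMaxClique i) hx hy hxy).1 h))

/-- A geodesic from `x` to `y` keeps the coordinate `j` and crosses an edge of class `i`. The clique
of that edge is constant in `j` and projects onto all of `repClique i`. -/
theorem exists_coord_of_ne {i j : ParallelClass hX} (hij : i ≠ j) {x y : V}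
    (hj : coord hX x j = coord hX y j) (hi : coord hX x i ≠ coord hX y i) {s : V}
    (hs : s ∈ repClique i) : ∃ z, coord hX z i = s ∧ coord hX z j = coord hX y j := by
  obtain ⟨u, v, huv, hne, hd⟩ := exists_crossing hX.connected (fun w => coord hX w i) hi
  have hu := ((coord_isCoordEmbedding hX).between_iff).1
    (between_left_of_crossing hX.connected huv hd) j
  rw [hj, or_self] at hu
  obtain ⟨D, hD, huD, hvD⟩ := exists_isMaxClique_of_adj huv
  obtain rfl := (coord_ne_iff hD huD hvD huv.ne).1 hne
  obtain ⟨z, hz, rfl⟩ := exists_coord_eq hD hs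
  refine ⟨z, rfl, ?_⟩
  rw [← hu]
  by_cases hzu : z = u
  · rw [hzu]
  · by_contra h
    exact hij ((coord_ne_iff hD hz huD hzu).1 h)

/-- The image of a paraclique graph in a product of two factors is everything or a cross. -/
theorem full_or_cross {i j : ParallelClass hX} (hij : i ≠ j) :
    (∀ s ∈ repClique i, ∀ t ∈ repClique j, ∃ x, coord hX x i = s ∧ coord hX x j = t) ∨
    ∃ a ∈ repClique i, ∃ b ∈ repClique j, (∀ x, coord hX x i = a ∨ coord hX x j = b) ∧
      (∀ s ∈ repClique i, coord hX s j = b) ∧ ∀ t ∈ repClique j, coord hX t i = a := by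
  have := hX.connected.nonempty
  obtain ⟨s₀, hs₀⟩ := (repClique_isMaxClique i).nonempty
  obtain ⟨t₀, ht₀⟩ := (repClique_isMaxClique j).nonempty
  have hb : ∀ s ∈ repClique i, coord hX s j = coord hX s₀ j :=
    fun s hs => coord_eq_of_mem_repClique hij hs hs₀
  have ha : ∀ t ∈ repClique j, coord hX t i = coord hX t₀ i :=
    fun t ht => coord_eq_of_mem_repClique hij.symm ht ht₀
  by_cases h : ∀ x, coord hX x i = coord hX t₀ i ∨ coord hX x j = coord hX s₀ j
  · exact .inr ⟨_, coord_mem _ _, _, coord_mem _ _, h, hb, ha⟩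
  · push Not at h
    obtain ⟨x, hxi, hxj⟩ := h
    refine .inl fun s hs t ht => ?_
    -- Comparing `x`, which is off the cross, with its gate in `repClique j` fills the row at height
    -- `coord hX x j`. Each point of this row, compared with a point of `repClique i`, then fills
    -- its column.
    have h1 : coord hX (coord hX x j) j = coord hX x j := coord_of_mem (coord_mem x j)
    obtain ⟨z, hz, hz'⟩ := exists_coord_of_ne hij h1
      (by rw [ha _ (coord_mem x j)]; exact hxi.symm) hs
    obtain ⟨w, hw, hw'⟩ := exists_coord_of_ne hij.symm (x := z) (y := s)
      (by rw [hz, coord_of_mem hs]) (by rw [hz', hb s hs]; exact hxj) ht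
    exact ⟨w, by rw [hw', coord_of_mem hs], hw⟩

end Coord

end Paraclique

/-! ### The quasi-median hull and the folding retraction onto it. -/

namespace Paraclique

/-- Non-expanding maps that do not increase a potential compose, possibly transfinitely, to a
retraction onto their common fixed points. -/
theorem exists_common_retraction {α : Type*} (near : α → α → Prop) (Φ : α → ℕ) (F : Set (α → α))
    (hF : ∀ φ ∈ F, ∀ x y, near x y → near (φ x) (φ y))
    (hΦ : ∀ φ ∈ F, ∀ x, φ x = x ∨ Φ (φ x) < Φ x) :
    ∃ r : α → α, (∀ x y, near x y → near (r x) (r y)) ∧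
      (∀ x, (∀ φ ∈ F, φ x = x) → r x = x) ∧ ∀ x, ∀ φ ∈ F, φ (r x) = r x := by
  let R := {r : α → α // (∀ x y, near x y → near (r x) (r y)) ∧
    ∀ x, (∀ φ ∈ F, φ x = x) → r x = x}
  -- A later map changes a value only by lowering its potential, so along a chain each point
  -- stabilizes. The upper bound takes the stable values, and any two of them are attained by a
  -- single member of the chain.
  let le : R → R → Prop := fun r s => ∀ x, s.1 x = r.1 x ∨ Φ (s.1 x) < Φ (r.1 x)
  have le_trans : ∀ {a b c : R}, le a b → le b c → le a c := by
    intro a b c hab hbc x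
    rcases hab x with h | h <;> rcases hbc x with h' | h'
    · exact .inl (h'.trans h)
    · exact .inr (h ▸ h')
    · exact .inr (h' ▸ h)
    · exact .inr (h'.trans h)
  obtain ⟨r, hr⟩ : ∃ m : R, ∀ a, le m a → le a m := by
    refine exists_maximal_of_chains_bounded (fun c hc => ?_) le_trans
    rcases c.eq_empty_or_nonempty with rfl | hne
    · exact ⟨⟨id, fun _ _ h => h, fun _ _ => rfl⟩, by simp⟩
    have hmin : ∀ x, ∃ s ∈ c, ∀ t ∈ c, Φ (s.1 x) ≤ Φ (t.1 x) := fun x => by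
      obtain ⟨s, hs, hs'⟩ := WellFounded.has_min (measure fun t : R => Φ (t.1 x)).wf c hne
      exact ⟨s, hs, fun t ht => not_lt.1 (hs' t ht)⟩
    choose s hs hs' using hmin
    have hstable : ∀ x, ∀ t ∈ c, le (s x) t → t.1 x = (s x).1 x := fun x t ht h =>
      (h x).resolve_right (hs' x t ht).not_gt
    have htotal : ∀ a ∈ c, ∀ b ∈ c, le a b ∨ le b a := fun a ha b hb => by
      by_cases hab : a = b
      · exact .inl fun x => .inl (by rw [hab])
      · exact hc ha hb hab
    refine ⟨⟨fun x => (s x).1 x, fun x y hxy => ?_, fun x hx => (s x).2.2 x hx⟩, fun a ha x => ?_⟩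
    · rcases htotal _ (hs x) _ (hs y) with h | h
      · have := (s y).2.1 x y hxy
        rwa [hstable x _ (hs y) h] at this
      · have := (s x).2.1 x y hxy
        rwa [hstable y _ (hs x) h] at this
    · rcases htotal a ha _ (hs x) with h | h
      · exact h x
      · exact .inl (hstable x a ha h).symm
  refine ⟨r.1, r.2.1, r.2.2, fun x φ hφ => ?_⟩
  let r' : R := ⟨φ ∘ r.1, fun x y hxy => hF φ hφ _ _ (r.2.1 x y hxy), fun x hx => by
    rw [Function.comp_apply, r.2.2 x hx, hx φ hφ]⟩
  rcases hΦ φ hφ (r.1 x) with h | h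
  · exact h
  · rcases hr r' (fun y => hΦ φ hφ (r.1 y)) x with h' | h'
    · exact h'.symm
    · exact absurd h h'.not_gt

variable {V : Type u} {X : SimpleGraph V}

/-- The vertices of the Hamming graph into which a paraclique graph embeds. -/
abbrev HammingHull (hX : IsParaclique X) (x₀ : V) : Type u :=
  {f : ParallelClass hX → V // {i | f i ≠ coord hX x₀ i}.Finite}

/-- Every pair of coordinates is realized by a vertex of the paraclique graph. -/
def IsCoherent (hX : IsParaclique X) (f : ParallelClass hX → V) : Prop :=
  ∀ i j, ∃ x, coord hX x i = f i ∧ coord hX x j = f j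

/-- The vertices of the quasi-median hull. -/
abbrev Hull (hX : IsParaclique X) (x₀ : V) : Type u :=
  {f : HammingHull hX x₀ // IsCoherent hX f.1}

/-- The quasi-median hull of a paraclique graph. -/
noncomputable def hullGraph (hX : IsParaclique X) (x₀ : V) : SimpleGraph (Hull hX x₀) :=
  (hammingGraph (fun _ : ParallelClass hX => V) (coord hX x₀)).comap Subtype.val

variable {hX : IsParaclique X} {x₀ : V}

theorem exists_coord_ne [Nontrivial V] (hX : IsParaclique X) (x₀ : V) (i : ParallelClass hX) :
    ∃ x, coord hX x i ≠ coord hX x₀ i := by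
  obtain ⟨a, ha, hne⟩ := ((repClique_isMaxClique i).nontrivial hX.connected).exists_ne (coord hX x₀ i)
  exact ⟨a, by rwa [coord_of_mem ha]⟩

/-- The distance from the base point to a hyperplane. -/
noncomputable def height (hX : IsParaclique X) (x₀ : V) (i : ParallelClass hX) : ℕ :=
  sInf {n | ∃ x, coord hX x i ≠ coord hX x₀ i ∧ X.dist x₀ x = n}

/-- Leaving the sector of `x₀` in direction `j` is possible only where the coordinate `i` equals
`a`, so direction `i` must be crossed earlier. The vertex just before a nearest crossing of `j`
witnesses this. -/
theorem height_lt_height [Nontrivial V] {i j : ParallelClass hX} (hij : i ≠ j) {a b : V}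
    (h : ∀ x, coord hX x i = a ∨ coord hX x j = b) (ha : coord hX x₀ i ≠ a)
    (hb : coord hX x₀ j = b) : height hX x₀ i < height hX x₀ j := by
  obtain ⟨y, hy⟩ := exists_coord_ne hX x₀ j
  obtain ⟨x, hx, hd⟩ := Nat.sInf_mem
    (s := {n | ∃ x, coord hX x j ≠ coord hX x₀ j ∧ X.dist x₀ x = n}) ⟨_, y, hy, rfl⟩
  obtain ⟨z, hxz, hz⟩ := exists_adj_dist hX.connected (x := x) (y := x₀) (by rintro rfl; exact hx rfl)
  rw [X.dist_comm, X.dist_comm (u := x)] at hz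
  have hzj : coord hX z j = coord hX x₀ j := by
    by_contra hne
    have : height hX x₀ j ≤ X.dist x₀ z := Nat.sInf_le ⟨z, hne, rfl⟩
    rw [height] at this
    omega
  have hzi : coord hX z i = coord hX x i := by
    by_contra hne
    exact hij ((coord_isCoordEmbedding hX).label_unique hxz (Ne.symm hne) (hzj ▸ hx))
  have hxi : coord hX x i = a := (h x).resolve_right (hb ▸ hx)
  have : height hX x₀ i ≤ X.dist x₀ z := Nat.sInf_le ⟨z, by rw [hzi, hxi]; exact ha.symm, rfl⟩
  rw [height, height] at *
  omega

open Classical in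
/-- Bring the coordinate `i` back into its clique. -/
noncomputable def foldOne (hX : IsParaclique X) (x₀ : V) (i : ParallelClass hX)
    (f : HammingHull hX x₀) : HammingHull hX x₀ :=
  if f.1 i ∈ repClique i then f else
    ⟨Function.update f.1 i (coord hX x₀ i), f.2.subset fun k hk => by
      by_cases hki : k = i
      · subst hki; simp at hk
      · simpa [hki] using hk⟩

open Classical in
/-- Fold the square spanned by the coordinates `i` and `j` onto the cross centred at `(a, b)`. -/
noncomputable def foldTwo (hX : IsParaclique X) (x₀ : V) (i j : ParallelClass hX) (a b : V)
    (f : HammingHull hX x₀) : HammingHull hX x₀ :=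
  if f.1 i = a ∨ f.1 j = b then f else
    ⟨fun k => if k = i then a else if k = j then b else f.1 k,
      ((f.2.insert j).insert i).subset fun k hk => by
        by_cases hki : k = i
        · exact .inl hki
        by_cases hkj : k = j
        · exact .inr (.inl hkj)
        · exact .inr (.inr (by simpa [hki, hkj] using hk))⟩

/-- The potential that the folds decrease. -/
noncomputable def potential (hX : IsParaclique X) (x₀ : V) (f : HammingHull hX x₀) : ℕ :=
  ∑ i ∈ f.2.toFinset, (height hX x₀ i + 1)

/-- Two points with at most one distinct coordinate. -/
def Near {I α : Type*} (f g : I → α) : Prop := ∃ i, ∀ j, j ≠ i → f j = g j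

theorem near_foldOne (i : ParallelClass hX) {f g : HammingHull hX x₀} (h : Near f.1 g.1) :
    Near (foldOne hX x₀ i f).1 (foldOne hX x₀ i g).1 := by
  obtain ⟨k, hk⟩ := h
  refine ⟨k, fun j hj => ?_⟩
  have := hk j hj
  classical
  have key : ∀ f : HammingHull hX x₀, (foldOne hX x₀ i f).1 j =
      if f.1 i ∈ repClique i then f.1 j else if j = i then coord hX x₀ i else f.1 j := by
    intro f
    unfold foldOne
    split_ifs <;> simp_all
  rw [key, key]
  by_cases hji : j = i
  · subst hji
    rw [this]
  · simp [hji, this]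

open Classical in
theorem foldTwo_apply {i j : ParallelClass hX} {a b : V} (f : HammingHull hX x₀)
    (k : ParallelClass hX) : (foldTwo hX x₀ i j a b f).1 k =
      if f.1 i = a ∨ f.1 j = b then f.1 k else if k = i then a else if k = j then b else f.1 k := by
  unfold foldTwo
  split_ifs <;> simp_all

/-- The delicate case has exactly one of the two points off the cross, say because they differ at
`i`. The point on the cross has `i`-th coordinate `a` and the other is sent to the centre, so their
images differ only at `j`. -/
theorem near_foldTwo {i j : ParallelClass hX} (hij : i ≠ j) (a b : V) {f g : HammingHull hX x₀}
    (h : Near f.1 g.1) :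
    Near (foldTwo hX x₀ i j a b f).1 (foldTwo hX x₀ i j a b g).1 := by
  obtain ⟨k, hk⟩ := h
  by_cases hki : k = i
  · subst hki
    have hj := hk j hij.symm
    by_cases hb : f.1 j = b
    · refine ⟨k, fun l hl => ?_⟩
      rw [foldTwo_apply, foldTwo_apply, if_pos (.inr hb), if_pos (.inr (hj ▸ hb)), hk l hl]
    · by_cases hfa : f.1 k = a <;> by_cases hga : g.1 k = a
      · refine ⟨k, fun l hl => ?_⟩
        rw [foldTwo_apply, foldTwo_apply, if_pos (.inl hfa), if_pos (.inl hga), hk l hl]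
      · refine ⟨j, fun l hl => ?_⟩
        rw [foldTwo_apply, foldTwo_apply]
        grind
      · refine ⟨j, fun l hl => ?_⟩
        rw [foldTwo_apply, foldTwo_apply]
        grind
      · refine ⟨k, fun l hl => ?_⟩
        rw [foldTwo_apply, foldTwo_apply]
        grind
  · have hi := hk i (Ne.symm hki)
    by_cases hkj : k = j
    · subst hkj
      by_cases ha : f.1 i = a
      · refine ⟨k, fun l hl => ?_⟩
        rw [foldTwo_apply, foldTwo_apply, if_pos (.inl ha), if_pos (.inl (hi ▸ ha)), hk l hl]
      · by_cases hfa : f.1 k = b <;> by_cases hga : g.1 k = b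
        · refine ⟨k, fun l hl => ?_⟩
          rw [foldTwo_apply, foldTwo_apply]
          grind
        · refine ⟨i, fun l hl => ?_⟩
          rw [foldTwo_apply, foldTwo_apply]
          grind
        · refine ⟨i, fun l hl => ?_⟩
          rw [foldTwo_apply, foldTwo_apply]
          grind
        · refine ⟨k, fun l hl => ?_⟩
          rw [foldTwo_apply, foldTwo_apply]
          grind
    · have hj := hk j (Ne.symm hkj)
      refine ⟨k, fun l hl => ?_⟩
      rw [foldTwo_apply, foldTwo_apply, hi, hj, hk l hl]

theorem potential_foldOne (i : ParallelClass hX) (f : HammingHull hX x₀) :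
    foldOne hX x₀ i f = f ∨ potential hX x₀ (foldOne hX x₀ i f) < potential hX x₀ f := by
  classical
  by_cases h : f.1 i ∈ repClique i
  · exact .inl (if_pos h)
  · refine .inr ?_
    have hne : f.1 i ≠ coord hX x₀ i := fun h' => h (h' ▸ coord_mem x₀ i)
    refine Finset.sum_lt_sum_of_subset (i := i) (fun k hk => ?_) ?_ ?_ (by omega) (by simp)
    · rw [Set.Finite.mem_toFinset, Set.mem_ofPred_eq, foldOne, if_neg h] at hk
      by_cases hki : k = i
      · subst hki; simpa using hne
      · simpa [hki] using hk
    · simpa using hne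
    · simp [foldOne, h]

/-- The fold removes `j` from the support and may add `i`, but only when `a` is not the base value.
In that case `height_lt_height` makes the exchange profitable. -/
theorem potential_foldTwo [Nontrivial V] {i j : ParallelClass hX} (hij : i ≠ j) {a b : V}
    (h : ∀ x, coord hX x i = a ∨ coord hX x j = b) (hb : coord hX x₀ j = b)
    (f : HammingHull hX x₀) :
    foldTwo hX x₀ i j a b f = f ∨
      potential hX x₀ (foldTwo hX x₀ i j a b f) < potential hX x₀ f := by
  classical
  by_cases hf : f.1 i = a ∨ f.1 j = b
  · exact .inl (if_pos hf)
  refine .inr ?_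
  rw [not_or] at hf
  have hj : j ∈ f.2.toFinset := by
    rw [Set.Finite.mem_toFinset]
    exact fun h' => hf.2 (h'.trans hb)
  have hsub : ∀ k ∈ (foldTwo hX x₀ i j a b f).2.toFinset,
      k ∈ f.2.toFinset.erase j ∨ k = i ∧ coord hX x₀ i ≠ a := by
    intro k hk
    rw [Set.Finite.mem_toFinset, Set.mem_ofPred_eq, foldTwo_apply, if_neg (by tauto)] at hk
    rw [Finset.mem_erase, Set.Finite.mem_toFinset, Set.mem_ofPred_eq]
    grind
  rw [potential, potential, ← Finset.add_sum_erase _ _ hj]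
  by_cases ha : coord hX x₀ i = a
  · have : (foldTwo hX x₀ i j a b f).2.toFinset ⊆ f.2.toFinset.erase j :=
      fun k hk => (hsub k hk).resolve_right fun h' => h'.2 ha
    have := Finset.sum_le_sum_of_subset (f := fun i => height hX x₀ i + 1) this
    omega
  · have : (foldTwo hX x₀ i j a b f).2.toFinset ⊆ insert i (f.2.toFinset.erase j) :=
      fun k hk => Finset.mem_insert.2 ((hsub k hk).symm.imp And.left id)
    have h1 := Finset.sum_le_sum_of_subset (f := fun i => height hX x₀ i + 1) this
    have h2 := height_lt_height hij h ha hb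
    have h3 : ∑ k ∈ insert i (f.2.toFinset.erase j), (height hX x₀ k + 1)
        ≤ height hX x₀ i + 1 + ∑ k ∈ f.2.toFinset.erase j, (height hX x₀ k + 1) := by
      by_cases hmem : i ∈ f.2.toFinset.erase j
      · rw [Finset.insert_eq_of_mem hmem]; omega
      · rw [Finset.sum_insert hmem]
    omega

theorem isCoherent_coord (x : V) : IsCoherent hX (coord hX x) := fun _ _ => ⟨x, rfl, rfl⟩

theorem IsCoherent.mem {f : ParallelClass hX → V} (hf : IsCoherent hX f) (i : ParallelClass hX) :
    f i ∈ repClique i := by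
  obtain ⟨x, hx, -⟩ := hf i i
  exact hx ▸ coord_mem x i

/-- The common fixed points of the folds are the coherent families: by `full_or_cross`, each
coordinate lying in its clique and each pair lying on its cross, if there is one, is all that
coherence demands. -/
theorem exists_hull_retraction [Nontrivial V] (hX : IsParaclique X) (x₀ : V) :
    ∃ r : HammingHull hX x₀ → HammingHull hX x₀, (∀ f g, Near f.1 g.1 → Near (r f).1 (r g).1) ∧
      (∀ f, IsCoherent hX f.1 → r f = f) ∧ ∀ f, IsCoherent hX (r f).1 := by
  obtain ⟨r, hr, hfix, hrF⟩ := exists_common_retraction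
    (fun f g : HammingHull hX x₀ => Near f.1 g.1) (potential hX x₀)
    {φ | (∃ i, φ = foldOne hX x₀ i) ∨ ∃ i j a b, i ≠ j ∧ (∀ x, coord hX x i = a ∨ coord hX x j = b) ∧
      coord hX x₀ j = b ∧ φ = foldTwo hX x₀ i j a b}
    (by
      rintro _ (⟨i, rfl⟩ | ⟨i, j, a, b, hij, -, -, rfl⟩) f g h
      · exact near_foldOne i h
      · exact near_foldTwo hij a b h)
    (by
      rintro _ (⟨i, rfl⟩ | ⟨i, j, a, b, hij, h, hb, rfl⟩) f
      · exact potential_foldOne i f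
      · exact potential_foldTwo hij h hb f)
  refine ⟨r, hr, fun f hf => hfix f ?_, fun f => ?_⟩
  · rintro _ (⟨i, rfl⟩ | ⟨i, j, a, b, hij, h, hb, rfl⟩)
    · exact if_pos (hf.mem i)
    · obtain ⟨x, hxi, hxj⟩ := hf i j
      exact if_pos (hxi ▸ hxj ▸ h x)
  · have hmem : ∀ i, (r f).1 i ∈ repClique i := by
      intro i
      have := hrF f _ (.inl ⟨i, rfl⟩)
      by_contra h
      rw [foldOne, if_neg h] at this
      have h' := congrFun (congrArg Subtype.val this) i
      simp only [Function.update_self] at h'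
      exact h (h' ▸ coord_mem x₀ i)
    have hcross : ∀ i j a b, i ≠ j → (∀ x, coord hX x i = a ∨ coord hX x j = b) →
        coord hX x₀ j = b → (r f).1 i = a ∨ (r f).1 j = b := by
      intro i j a b hij h hb
      have := hrF f _ (.inr ⟨i, j, a, b, hij, h, hb, rfl⟩)
      by_contra h'
      have h1 := congrFun (congrArg Subtype.val this) i
      rw [foldTwo_apply, if_neg h', if_pos rfl] at h1
      exact h' (.inl h1.symm)
    intro i j
    by_cases hij : i = j
    · subst hij
      exact ⟨(r f).1 i, coord_of_mem (hmem i), coord_of_mem (hmem i)⟩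
    · rcases full_or_cross hij with h | ⟨a, -, b, -, h, hb, ha⟩
      · exact h _ (hmem i) _ (hmem j)
      -- Folds are available only when `x₀` lies on the arm where the second coordinate is central.
      -- Since `x₀` lies on some arm, one ordering of the pair qualifies.
      · have : (r f).1 i = a ∨ (r f).1 j = b := by
          rcases h x₀ with h' | h'
          · exact (hcross j i b a (Ne.symm hij) (fun x => (h x).symm) h').symm
          · exact hcross i j a b hij h h'
        rcases this with h' | h'
        · exact ⟨(r f).1 j, by rw [ha _ (hmem j), h'], coord_of_mem (hmem j)⟩
        · exact ⟨(r f).1 i, coord_of_mem (hmem i), by rw [hb _ (hmem i), h']⟩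

theorem coord_finite_ne (x y : V) : {i | coord hX x i ≠ coord hX y i}.Finite := by
  rw [← Set.encard_ne_top_iff, coord_isCoordEmbedding hX]
  exact ENat.natCast_ne_top _

/-- The embedding of a paraclique graph into its quasi-median hull. -/
noncomputable def toHull (hX : IsParaclique X) (x₀ x : V) : Hull hX x₀ :=
  ⟨⟨coord hX x, coord_finite_ne x x₀⟩, isCoherent_coord x⟩

theorem hullGraph_adj {f g : Hull hX x₀} : (hullGraph hX x₀).Adj f g ↔
    ∃ i, f.1.1 i ≠ g.1.1 i ∧ ∀ j, j ≠ i → f.1.1 j = g.1.1 j :=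
  Iff.rfl

theorem near_iff {f g : HammingHull hX x₀} : Near f.1 g.1 ↔ (Nonempty (ParallelClass hX) ∧ f = g) ∨
    (hammingGraph (fun _ : ParallelClass hX => V) (coord hX x₀)).Adj f g := by
  constructor
  · rintro ⟨i, hi⟩
    by_cases h : f.1 i = g.1 i
    · refine .inl ⟨⟨i⟩, Subtype.ext (funext fun j => ?_)⟩
      by_cases hj : j = i
      · exact hj ▸ h
      · exact hi j hj
    · exact .inr ⟨i, h, hi⟩
  · rintro (⟨⟨i⟩, rfl⟩ | ⟨i, -, hi⟩)
    exacts [⟨i, fun _ _ => rfl⟩, ⟨i, hi⟩]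

theorem exists_retraction_hullGraph (hX : IsParaclique X) (x₀ : V) :
    ∃ r : HammingHull hX x₀ → Hull hX x₀,
      (∀ f g, (hammingGraph (fun _ : ParallelClass hX => V) (coord hX x₀)).Adj f g →
        r f = r g ∨ (hullGraph hX x₀).Adj (r f) (r g)) ∧ ∀ f, r f.1 = f := by
  -- Over a one-vertex graph no height is attained, but the hull is a single point.
  rcases subsingleton_or_nontrivial V with hV | hV
  · exact ⟨fun f => toHull hX x₀ x₀, fun _ _ _ => .inl rfl, fun _ => Subsingleton.elim _ _⟩
  · obtain ⟨r, hr, hfix, hrc⟩ := exists_hull_retraction hX x₀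
    refine ⟨fun f => ⟨r f, hrc f⟩, fun f g h => ?_, fun f => Subtype.ext (hfix f.1 f.2)⟩
    rcases near_iff.1 (hr f g (near_iff.2 (.inr h))) with h | h
    · exact .inl (Subtype.ext h.2)
    · exact .inr h

theorem hullGraph_isQuasiMedian (hX : IsParaclique X) (x₀ : V) :
    IsQuasiMedian (hullGraph hX x₀) := by
  obtain ⟨r, hr, hre⟩ := exists_retraction_hullGraph hX x₀
  exact ⟨_, _, _, Subtype.val, r, fun _ _ h => h, hr, hre⟩

theorem hullGraph_connected (hX : IsParaclique X) (x₀ : V) : (hullGraph hX x₀).Connected := by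
  obtain ⟨r, hr, hre⟩ := exists_retraction_hullGraph hX x₀
  exact connected_of_retraction (hammingGraph_connected _ _) hr hre

theorem hullGraph_isCoordEmbedding (hX : IsParaclique X) (x₀ : V) :
    IsCoordEmbedding (hullGraph hX x₀) fun f => f.1.1 := by
  obtain ⟨r, hr, hre⟩ := exists_retraction_hullGraph hX x₀
  intro f g
  rw [← dist_eq_of_retraction (hammingGraph_connected _ _) (e := Subtype.val) (fun _ _ h => h) hr hre]
  exact hammingGraph_isCoordEmbedding _ _ f.1 g.1

theorem toHull_isIsometricEmbedding (hX : IsParaclique X) (x₀ : V) :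
    IsIsometricEmbedding X (hullGraph hX x₀) (toHull hX x₀) := by
  intro x y
  rw [← ENat.natCast_inj, ← hullGraph_isCoordEmbedding hX x₀, ← coord_isCoordEmbedding hX]
  rfl

end Paraclique

/-! ### Cliques, parallelism and hyperplanes of the hull. -/

namespace Paraclique

/-- The three edges of a triangle carry the same label, so a clique varies in a single coordinate.
-/
theorem IsCoordEmbedding.eq_of_clique {V I : Type*} {K : I → Type*} {G : SimpleGraph V}
    {c : V → ∀ i, K i} (hc : IsCoordEmbedding G c) {x y z : V} (hxy : G.Adj x y)
    (hxz : x = z ∨ G.Adj x z) (hyz : y = z ∨ G.Adj y z) {i j : I} (hi : c x i ≠ c y i)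
    (hj : j ≠ i) : c z j = c x j := by
  have key : ∀ {k}, c x k ≠ c y k → k = i := fun hk => hc.label_unique hxy hk hi
  rcases hxz with rfl | hxz
  · rfl
  rcases hyz with rfl | hyz
  · by_contra h
    exact hj (key (Ne.symm h))
  by_contra h
  have hxi : c x i = c z i := by
    by_contra h'
    exact hj (hc.label_unique hxz (Ne.symm h) h')
  have hyj : c y j ≠ c z j := by
    intro h'
    exact hj (key fun h'' => h (h'.symm.trans h''.symm))
  exact hj (hc.label_unique hyz hyj (hxi ▸ hi.symm))

variable {V : Type u} {X : SimpleGraph V} {hX : IsParaclique X} {x₀ : V}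

theorem toHull_injective (hX : IsParaclique X) (x₀ : V) : Function.Injective (toHull hX x₀) := by
  intro x y h
  exact (coord_isCoordEmbedding hX).injective hX.connected
    (congrArg (fun f : Hull hX x₀ => f.1.1) h)

theorem parallelClass_nonempty (hX : IsParaclique X) : Nonempty (ParallelClass hX) := by
  obtain ⟨C, hC, -⟩ := exists_isMaxClique_of_isClique (G := X) (A := ∅) (by simp)
  exact ⟨parallelClass hX hC⟩

theorem nontrivial_of_ne {i j : ParallelClass hX} (hij : i ≠ j) : Nontrivial V := by
  have := hX.connected.nonempty
  by_contra h
  rw [not_nontrivial_iff_subsingleton] at h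
  refine hij ?_
  rw [← parallelClass_repClique i, ← parallelClass_repClique j, parallelClass_eq_iff,
    (repClique_isMaxClique i).nonempty.eq_univ, (repClique_isMaxClique j).nonempty.eq_univ]
  exact Parallel.refl hX.connected _

/-- `D` consists of all the vertices of the hull that differ from a given one only at `i`. -/
def IsLine (D : Set (Hull hX x₀)) (i : ParallelClass hX) : Prop :=
  D.Nonempty ∧ ∀ f ∈ D, ∀ g, g ∈ D ↔ ∀ j, j ≠ i → g.1.1 j = f.1.1 j

theorem IsLine.eq {D : Set (Hull hX x₀)} {i : ParallelClass hX} (h : IsLine D i)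
    {f g : Hull hX x₀} (hf : f ∈ D) (hg : g ∈ D) (hfg : f.1.1 i = g.1.1 i) : f = g := by
  refine Subtype.ext (Subtype.ext (funext fun j => ?_))
  by_cases hj : j = i
  · exact hj ▸ hfg
  · exact ((h.2 g hg f).1 hf) j hj

theorem isLine_of_mem {f : Hull hX x₀} {i : ParallelClass hX} {D : Set (Hull hX x₀)}
    (hf : f ∈ D) (h : ∀ g, g ∈ D ↔ ∀ j, j ≠ i → g.1.1 j = f.1.1 j) : IsLine D i := by
  refine ⟨⟨f, hf⟩, fun f' hf' g => ?_⟩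
  rw [h]
  refine forall₂_congr fun j hj => ?_
  rw [(h f').1 hf' j hj]

theorem IsLine.isClique {D : Set (Hull hX x₀)} {i : ParallelClass hX} (h : IsLine D i) :
    (hullGraph hX x₀).IsClique D := by
  intro f hf g hg hfg
  exact hullGraph_adj.2 ⟨i, fun h' => hfg (h.eq hf hg h'), (h.2 g hg f).1 hf⟩

theorem exists_isLine {D : Set (Hull hX x₀)} (hD : IsMaxClique (hullGraph hX x₀) D) :
    ∃ i, IsLine D i := by
  have hne := (hullGraph_connected hX x₀).nonempty
  rcases subsingleton_or_nontrivial (Hull hX x₀) with hV | hV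
  · obtain ⟨i⟩ := parallelClass_nonempty hX
    obtain ⟨f, hf⟩ := hD.nonempty
    exact ⟨i, isLine_of_mem hf fun g => by simp [Subsingleton.elim g f, hf]⟩
  · obtain ⟨f, hf, g, hg, hfg⟩ := hD.nontrivial (hullGraph_connected hX x₀)
    have hadj := hD.1 hf hg hfg
    obtain ⟨i, hi, -⟩ := hullGraph_adj.1 hadj
    have hline : IsLine {h : Hull hX x₀ | ∀ j, j ≠ i → h.1.1 j = f.1.1 j} i :=
      isLine_of_mem (f := f) (by simp) fun _ => Iff.rfl
    have heq := hD.eq_of_subset hline.isClique fun h hh j hj =>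
      (hullGraph_isCoordEmbedding hX x₀).eq_of_clique hadj
        (or_iff_not_imp_left.2 fun h' => hD.1 hf hh h')
        (or_iff_not_imp_left.2 fun h' => hD.1 hg hh h') hi hj
    exact ⟨i, heq ▸ hline⟩

/-- If the pair `i, j` forms a cross, two distinct values at `i` with the same value at `j` force
the latter to be central, so every value at `i` is compatible with it. Hence an edge of the hull
spans a full copy of `repClique i`. -/
theorem isCoherent_update [DecidableEq (ParallelClass hX)] {f g : ParallelClass hX → V}
    (hf : IsCoherent hX f) (hg : IsCoherent hX g) {i : ParallelClass hX} (hi : f i ≠ g i)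
    (hfg : ∀ j, j ≠ i → f j = g j) {a : V} (ha : a ∈ repClique i) :
    IsCoherent hX (Function.update f i a) := by
  have key : ∀ j, j ≠ i → ∃ x, coord hX x i = a ∧ coord hX x j = f j := by
    intro j hj
    rcases full_or_cross (Ne.symm hj) with h | ⟨a', -, b', -, h, hb, -⟩
    · exact h a ha _ (hf.mem j)
    · refine ⟨a, coord_of_mem ha, (hb a ha).trans ?_⟩
      obtain ⟨x, hxi, hxj⟩ := hf i j
      obtain ⟨y, hyi, hyj⟩ := hg i j
      rw [← hfg j hj] at hyj
      rcases h x with h1 | h1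
      · rcases h y with h2 | h2
        · exact absurd (hxi.symm.trans (h1.trans (h2.symm.trans hyi))) hi
        · exact h2.symm.trans hyj
      · exact h1.symm.trans hxj
  intro j k
  by_cases hj : j = i
  · subst hj
    by_cases hk : k = j
    · subst hk
      exact ⟨a, by simp [coord_of_mem ha]⟩
    · obtain ⟨x, h1, h2⟩ := key k hk
      exact ⟨x, by simp [h1], by simp [hk, h2]⟩
  · by_cases hk : k = i
    · subst hk
      obtain ⟨x, h1, h2⟩ := key j hj
      exact ⟨x, by simp [hj, h2], by simp [h1]⟩
    · obtain ⟨x, h1, h2⟩ := hf j k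
      exact ⟨x, by simp [hj, h1], by simp [hk, h2]⟩

theorem IsLine.exists_mem {D : Set (Hull hX x₀)} (hD : IsMaxClique (hullGraph hX x₀) D)
    {i : ParallelClass hX} (h : IsLine D i) {a : V} (ha : a ∈ repClique i) :
    ∃ f ∈ D, f.1.1 i = a := by
  classical
  rcases subsingleton_or_nontrivial V with hV | hV
  · exact h.1.imp fun f hf => ⟨hf, Subsingleton.elim _ _⟩
  · have := (toHull_injective hX x₀).nontrivial
    obtain ⟨f, hf, g, hg, hfg⟩ := hD.nontrivial (hullGraph_connected hX x₀)
    have hi : f.1.1 i ≠ g.1.1 i := fun h' => hfg (h.eq hf hg h')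
    let f' : Hull hX x₀ := ⟨⟨Function.update f.1.1 i a, (f.1.2.insert i).subset fun j hj => by
      by_cases hji : j = i
      · exact .inl hji
      · exact .inr (by simpa [hji] using hj)⟩,
      isCoherent_update f.2 g.2 hi ((h.2 g hg f).1 hf) ha⟩
    exact ⟨f', (h.2 f hf f').2 fun j hj => by simp [f', hj], by simp [f']⟩

theorem IsLine.isGate {D : Set (Hull hX x₀)} {i : ParallelClass hX} (h : IsLine D i)
    {f g : Hull hX x₀} (hg : g ∈ D) (hfg : g.1.1 i = f.1.1 i) :
    IsGate (hullGraph hX x₀) D f g := by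
  refine (isGate_iff (hullGraph_connected hX x₀)).2 ⟨hg, fun y hy => ?_⟩
  rw [(hullGraph_isCoordEmbedding hX x₀).between_iff]
  intro j
  by_cases hj : j = i
  · exact .inl (hj ▸ hfg)
  · exact .inr ((h.2 y hy g).1 hg j hj)

/-- Projecting to a line in direction `j` reads off the `j`-th coordinate. This is constant on a
line in another direction and bijective on one in the same direction. -/
theorem IsLine.parallel_iff {D E : Set (Hull hX x₀)} (hD : IsMaxClique (hullGraph hX x₀) D)
    (hE : IsMaxClique (hullGraph hX x₀) E) {i j : ParallelClass hX} (hi : IsLine D i)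
    (hj : IsLine E j) : Parallel (hullGraph hX x₀) D E ↔ i = j := by
  constructor
  · intro h
    by_contra hij
    have := nontrivial_of_ne hij
    have := (toHull_injective hX x₀).nontrivial
    obtain ⟨f, hf, g, hg, hfg⟩ := hD.nontrivial (hullGraph_connected hX x₀)
    obtain ⟨p, hp, hpf⟩ := hj.exists_mem hE (f.2.mem j)
    refine hfg (h.gate_injOn (hullGraph_connected hX x₀) hf hg (hj.isGate hp hpf)
      (hj.isGate hp (hpf.trans ?_)))
    exact (hi.2 g hg f).1 hf j (Ne.symm hij)
  · rintro rfl
    have : ∀ f : Hull hX x₀, ∃ g ∈ E, g.1.1 i = f.1.1 i := fun f => hj.exists_mem hE (f.2.mem i)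
    choose φ hφ hφi using this
    refine ⟨φ, fun f _ => hj.isGate (hφ f) (hφi f), fun f _ => hφ f, fun f hf g hg hfg => ?_,
      fun g hg => ?_⟩
    · exact hi.eq hf hg (by rw [← hφi f, ← hφi g, hfg])
    · obtain ⟨f, hf, hfg⟩ := hi.exists_mem hD (g.2.mem i)
      exact ⟨f, hf, hj.eq (hφ f) hg ((hφi f).trans hfg)⟩

theorem toHull_image_isLine {C : Set V} (hC : IsMaxClique X C) :
    IsLine (toHull hX x₀ '' C) (parallelClass hX hC) := by
  have := hX.connected.nonempty
  obtain ⟨x, hx⟩ := hC.nonempty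
  have key : ∀ y ∈ C, ∀ j, j ≠ parallelClass hX hC → coord hX y j = coord hX x j := by
    intro y hy j hj
    by_cases hyx : y = x
    · rw [hyx]
    · by_contra h
      exact hj ((coord_ne_iff hC hy hx hyx).1 h).symm
  refine isLine_of_mem (f := toHull hX x₀ x) ⟨x, hx, rfl⟩ fun g => ⟨?_, fun h => ?_⟩
  · rintro ⟨y, hy, rfl⟩ j hj
    exact key y hy j hj
  · obtain ⟨z, hz, hzg⟩ := exists_coord_eq hC (g.2.mem (parallelClass hX hC))
    refine ⟨z, hz, Subtype.ext (Subtype.ext (funext fun j => ?_))⟩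
    by_cases hj : j = parallelClass hX hC
    · subst hj
      exact hzg
    · exact (key z hz j hj).trans (h j hj).symm

theorem toHull_image_isMaxClique {C : Set V} (hC : IsMaxClique X C) :
    IsMaxClique (hullGraph hX x₀) (toHull hX x₀ '' C) := by
  have := hX.connected.nonempty
  have hline : IsLine (toHull hX x₀ '' C) (parallelClass hX hC) := toHull_image_isLine hC
  refine ⟨hline.isClique, fun E hE hCE f hf => ?_⟩
  rcases subsingleton_or_nontrivial V with hV | hV
  · obtain ⟨g, hg⟩ := hline.1
    rwa [Subsingleton.elim f g]
  · obtain ⟨x, hx, y, hy, hxy⟩ := hC.nontrivial hX.connected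
    have hx' := Set.mem_image_of_mem (toHull hX x₀) hx
    have hy' := Set.mem_image_of_mem (toHull hX x₀) hy
    have hne : toHull hX x₀ x ≠ toHull hX x₀ y := (toHull_injective hX x₀).ne hxy
    refine (hline.2 _ hx' f).2 fun j hj => ?_
    exact (hullGraph_isCoordEmbedding hX x₀).eq_of_clique (hline.isClique hx' hy' hne)
      (or_iff_not_imp_left.2 fun h => hE (hCE hx') hf h)
      (or_iff_not_imp_left.2 fun h => hE (hCE hy') hf h)
      ((coord_ne_iff hC hx hy hxy).2 rfl) hj

theorem exists_parallel_toHull_image {D : Set (Hull hX x₀)}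
    (hD : IsMaxClique (hullGraph hX x₀) D) :
    ∃ C, IsMaxClique X C ∧ Parallel (hullGraph hX x₀) D (toHull hX x₀ '' C) := by
  obtain ⟨i, hi⟩ := exists_isLine hD
  have hC := repClique_isMaxClique i
  exact ⟨_, hC, (hi.parallel_iff hD (toHull_image_isMaxClique hC) (toHull_image_isLine hC)).2
    (parallelClass_repClique i).symm⟩

theorem parallel_toHull_image_iff {C₁ C₂ : Set V} (h₁ : IsMaxClique X C₁)
    (h₂ : IsMaxClique X C₂) :
    Parallel (hullGraph hX x₀) (toHull hX x₀ '' C₁) (toHull hX x₀ '' C₂) ↔ Parallel X C₁ C₂ := by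
  rw [(toHull_image_isLine h₁).parallel_iff (toHull_image_isMaxClique h₁)
    (toHull_image_isMaxClique h₂) (toHull_image_isLine h₂), parallelClass_eq_iff]

theorem hyperplane_eq_labelEdges {C : Set V} (hC : IsMaxClique X C) :
    hyperplane X C = labelEdges X (coord hX) (parallelClass hX hC) := by
  classical
  refine (coord_isCoordEmbedding hX).hyperplane_eq
    -- The value off the maximal cliques is irrelevant.
    (L := fun D => if h : IsMaxClique X D then parallelClass hX h else parallelClass hX hC)
    (fun D hD x hx y hy hxy => ?_) fun D hD => ?_
  · simp only [dif_pos hD]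
    exact (coord_ne_iff hD hx hy hxy).2 rfl
  · simp only [dif_pos hD]
    rw [eq_comm, parallelClass_eq_iff]

theorem hyperplane_toHull_image {C : Set V} (hC : IsMaxClique X C) :
    hyperplane (hullGraph hX x₀) (toHull hX x₀ '' C)
      = labelEdges (hullGraph hX x₀) (fun f => f.1.1) (parallelClass hX hC) := by
  have := parallelClass_nonempty hX
  choose! L hL using fun D (hD : IsMaxClique (hullGraph hX x₀) D) => exists_isLine hD
  refine (hullGraph_isCoordEmbedding hX x₀).hyperplane_eq (L := L)
    (fun D hD f hf g hg hfg h => hfg ((hL D hD).eq hf hg h)) fun D hD => ?_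
  rw [(toHull_image_isLine hC).parallel_iff (toHull_image_isMaxClique hC) hD (hL D hD), eq_comm]

/-- Transversality says that all combinations of two coordinates occur, and by coherence the hull
realizes the same pairs as `X`. -/
theorem transverse_toHull_image_iff {C₁ C₂ : Set V} (h₁ : IsMaxClique X C₁)
    (h₂ : IsMaxClique X C₂) :
    Transverse (hullGraph hX x₀) (hyperplane (hullGraph hX x₀) (toHull hX x₀ '' C₁))
      (hyperplane (hullGraph hX x₀) (toHull hX x₀ '' C₂)) ↔
    Transverse X (hyperplane X C₁) (hyperplane X C₂) := by
  rw [hyperplane_toHull_image h₁, hyperplane_toHull_image h₂,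
    hyperplane_eq_labelEdges (hX := hX) h₁, hyperplane_eq_labelEdges (hX := hX) h₂,
    (hullGraph_isCoordEmbedding hX x₀).transverse_iff (hullGraph_connected hX x₀),
    (coord_isCoordEmbedding hX).transverse_iff hX.connected]
  constructor
  · intro h x y
    obtain ⟨f, hfx, hfy⟩ := h (toHull hX x₀ x) (toHull hX x₀ y)
    obtain ⟨z, hz₁, hz₂⟩ := f.2 (parallelClass hX h₁) (parallelClass hX h₂)
    exact ⟨z, hz₁.trans hfx, hz₂.trans hfy⟩
  · intro h f g
    obtain ⟨x, hx, -⟩ := f.2 (parallelClass hX h₁) (parallelClass hX h₁)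
    obtain ⟨y, hy, -⟩ := g.2 (parallelClass hX h₂) (parallelClass hX h₂)
    obtain ⟨z, hz₁, hz₂⟩ := h x y
    exact ⟨toHull hX x₀ z, hz₁.trans hx, hz₂.trans hy⟩

end Paraclique

namespace Paraclique

/-! ### The dual discriminator and the Baker-Pixley argument. -/

section Majority

variable {I : Type*} {K : I → Type*}

open Classical in
/-- The dual discriminator: `g i` where `g` and `h` agree, and `f i` elsewhere. -/
noncomputable def majority (f g h : ∀ i, K i) : ∀ i, K i := fun i => if g i = h i then g i else f i

theorem majority_eq_of_left {f g h : ∀ i, K i} {i : I} {a : K i} (hf : f i = a)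
    (hgh : g i = a ∨ h i = a) : majority f g h i = a := by
  unfold majority
  split_ifs with h'
  · rcases hgh with h'' | h''
    · exact h''
    · exact h'.trans h''
  · exact hf

theorem majority_eq_of_right {f g h : ∀ i, K i} {i : I} {a : K i} (hg : g i = a) (hh : h i = a) :
    majority f g h i = a := by
  unfold majority
  rw [if_pos (hg.trans hh.symm), hg]

/-- A subset of a Hamming graph that is closed under majorities is determined by its projections
to pairs of coordinates. -/
theorem mem_of_majority_closed {A : Set (∀ i, K i)}
    (hA : ∀ f ∈ A, ∀ g ∈ A, ∀ h ∈ A, majority f g h ∈ A) {f : ∀ i, K i}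
    (hfin : ∀ a ∈ A, {i | a i ≠ f i}.Finite) (hne : A.Nonempty)
    (hf : ∀ i j, ∃ a ∈ A, a i = f i ∧ a j = f j) : f ∈ A := by
  classical
  -- The two free indices drive the induction: approximants correct at `i, j`, at `i, k` and at `j,
  -- k` leave at most one error at each of these indices, which the majority removes.
  have key : ∀ F : Finset I, ∀ i j, ∃ a ∈ A, a i = f i ∧ a j = f j ∧ ∀ k ∈ F, a k = f k := by
    intro F
    induction F using Finset.induction_on with
    | empty => simpa using hf
    | insert k F _ ih =>
      intro i j
      obtain ⟨t₁, h₁, h₁i, h₁j, h₁F⟩ := ih i j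
      obtain ⟨t₂, h₂, h₂i, h₂k, h₂F⟩ := ih i k
      obtain ⟨t₃, h₃, h₃j, h₃k, h₃F⟩ := ih j k
      refine ⟨_, hA t₁ h₁ t₂ h₂ t₃ h₃, majority_eq_of_left h₁i (.inl h₂i),
        majority_eq_of_left h₁j (.inr h₃j), fun l hl => ?_⟩
      rcases Finset.mem_insert.1 hl with rfl | hl
      · exact majority_eq_of_right h₂k h₃k
      · exact majority_eq_of_left (h₁F l hl) (.inl (h₂F l hl))
  have key' : ∀ F : Finset I, ∃ a ∈ A, ∀ k ∈ F, a k = f k := by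
    intro F
    rcases isEmpty_or_nonempty I with hI | ⟨⟨i⟩⟩
    · exact hne.imp fun a ha => ⟨ha, fun k => (hI.false k).elim⟩
    · obtain ⟨a, ha, -, -, h⟩ := key F i i
      exact ⟨a, ha, h⟩
  obtain ⟨a, ha⟩ := hne
  -- Agreement on finite sets suffices: `b` corrects the errors of `a`, and `c` corrects those of
  -- both, so at every index two of the three are right.
  obtain ⟨b, hb, hb'⟩ := key' (hfin a ha).toFinset
  obtain ⟨c, hc, hc'⟩ := key' ((hfin a ha).toFinset ∪ (hfin b hb).toFinset)
  convert hA a ha b hb c hc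
  funext i
  symm
  by_cases hai : a i = f i
  · by_cases hbi : b i = f i
    · exact majority_eq_of_left hai (.inl hbi)
    · exact majority_eq_of_left hai (.inr (hc' i (by simp [hbi])))
  · exact majority_eq_of_right (hb' i (by simpa using hai)) (hc' i (by simp [hai]))

end Majority

/-! ### Closure of retracts under the dual discriminator. -/

section Retract

variable {U : Type v} {Q : SimpleGraph U} {I : Type v} {K : I → Type v} {o : ∀ i, K i}
  {e : U → {f : ∀ i, K i // {i | f i ≠ o i}.Finite}}
  {r : {f : ∀ i, K i // {i | f i ≠ o i}.Finite} → U}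

/-- Retracts of Hamming graphs are closed under majorities. -/
theorem exists_eq_majority (he : ∀ x y, Q.Adj x y → (hammingGraph K o).Adj (e x) (e y))
    (hr : ∀ f g, (hammingGraph K o).Adj f g → r f = r g ∨ Q.Adj (r f) (r g))
    (hre : ∀ x, r (e x) = x) (x y z : U) :
    ∃ q, (e q).1 = majority (e x).1 (e y).1 (e z).1 := by
  classical
  have hH := hammingGraph_connected K o
  have hc := hammingGraph_isCoordEmbedding K o
  let m : {f : ∀ i, K i // {i | f i ≠ o i}.Finite} :=
    ⟨majority (e x).1 (e y).1 (e z).1, ((e x).2.union (e y).2).subset fun i hi => by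
      by_contra h
      simp only [Set.mem_union, Set.mem_ofPred_eq, not_or, not_not] at h
      exact hi (majority_eq_of_left h.1 (.inl h.2))⟩
  have hm : ∀ i, m.1 i = if (e y).1 i = (e z).1 i then (e y).1 i else (e x).1 i := by
    intro i
    simp only [m, majority]
  -- The point `m` lies on geodesics from `e x` to `e y` and to `e z`. Retracting brings it no
  -- farther from these three points, so `e (r m)` lies in both intervals at the same distance from
  -- `e x` as `m`. The coordinates also put it between `e x` and `m`, hence it equals `m`.
  have hle : ∀ w, (hammingGraph K o).dist (e w) (e (r m)) ≤ (hammingGraph K o).dist (e w) m := by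
    intro w
    rw [dist_eq_of_retraction hH he hr hre]
    simpa only [hre] using dist_map_le hH hr (e w) m
  have hxy := (hc.between_iff (x := e x) (y := e y) (z := m)).2 fun i => by
    rw [hm]; split_ifs <;> simp
  have hxz := (hc.between_iff (x := e x) (y := e z) (z := m)).2 fun i => by
    rw [hm]; split_ifs with h <;> simp [h]
  have h1 := hle x
  have h2 := hle y
  have h3 := hle z
  rw [(hammingGraph K o).dist_comm, (hammingGraph K o).dist_comm (u := e y)] at h2
  rw [(hammingGraph K o).dist_comm, (hammingGraph K o).dist_comm (u := e z)] at h3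
  have h4 := hH.dist_triangle (u := e x) (v := e (r m)) (w := e y)
  have h5 := hH.dist_triangle (u := e x) (v := e (r m)) (w := e z)
  have hxy' := (hc.between_iff (x := e x) (y := e y) (z := e (r m))).1 (by omega)
  have hxz' := (hc.between_iff (x := e x) (y := e z) (z := e (r m))).1 (by omega)
  have hbetween := (hc.between_iff (x := e x) (y := m) (z := e (r m))).2 fun i => by
    rw [hm]
    rcases hxy' i with h | h
    · exact .inl h
    · rcases hxz' i with h' | h'
      · exact .inl h'
      · rw [if_pos (h.symm.trans h')]
        exact .inr h
  refine ⟨r m, congrArg Subtype.val (?_ : e (r m) = m)⟩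
  exact hH.dist_eq_zero_iff.1 (by omega)

end Retract

/-! ### Universality of the hull. -/

section Universal

variable {V : Type u} {X : SimpleGraph V} {hX : IsParaclique X} {J : Type*} {L : J → Type*}
  {c : V → ∀ k, L k}

/-- The gates `p, q` of `x, y` in the clique `D` of the second edge have `x, y` as gates in return,
so betweenness carries the change at `k` over to `pq`. All edges of `D` then share that label. -/
theorem label_eq_of_coord (hX : IsParaclique X) (hc : IsCoordEmbedding X c)
    {x y x' y' : V} {i : ParallelClass hX} {k : J} (hxy : X.Adj x y) (hxy' : X.Adj x' y')
    (hi : coord hX x i ≠ coord hX y i) (hi' : coord hX x' i ≠ coord hX y' i)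
    (hk : c x k ≠ c y k) : c x' k ≠ c y' k := by
  obtain ⟨C, hC, hxC, hyC⟩ := exists_isMaxClique_of_adj hxy
  obtain ⟨D, hD, hxD, hyD⟩ := exists_isMaxClique_of_adj hxy'
  have hpar : Parallel X C D := parallelClass_eq_iff.1
    (((coord_ne_iff hC hxC hyC hxy.ne).1 hi).trans ((coord_ne_iff hD hxD hyD hxy'.ne).1 hi').symm)
  obtain ⟨p, hp⟩ := hX.gated D hD x
  obtain ⟨q, hq⟩ := hX.gated D hD y
  have hpq : p ≠ q := by
    rintro rfl
    exact hxy.ne (hpar.gate_injOn hX.connected hxC hyC hp hq)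
  have hpx := (isGate_iff hX.connected).1 (hX.isGate_symm hC hD hxC hyC hp hq hpq)
  have hqy := (isGate_iff hX.connected).1 (hX.isGate_symm hC hD hyC hxC hq hp hpq.symm)
  have h1 := (hc.between_iff.1 (hpx.2 y hyC) k).resolve_right hk
  have h2 := (hc.between_iff.1 (hqy.2 x hxC) k).resolve_right hk.symm
  have hpqk : c p k ≠ c q k := by rwa [← h1, ← h2]
  have hpq' := hD.1 hp.1 hq.1 hpq
  obtain ⟨l, hl, -⟩ := hc.adj_iff.1 hxy'
  by_cases hkl : k = l
  · exact hkl ▸ hl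
  · have key : ∀ z ∈ D, c z l = c p l := fun z hz =>
      hc.eq_of_clique hpq' (or_iff_not_imp_left.2 fun h => hD.1 hp.1 hz h)
        (or_iff_not_imp_left.2 fun h => hD.1 hq.1 hz h) hpqk (Ne.symm hkl)
    exact absurd ((key x' hxD).trans (key y' hyD).symm) hl

theorem exists_label [Nontrivial V] (hX : IsParaclique X) (hc : IsCoordEmbedding X c)
    (i : ParallelClass hX) :
    ∃ k, ∀ x y, X.Adj x y → coord hX x i ≠ coord hX y i → c x k ≠ c y k := by
  obtain ⟨a, ha, b, hb, hab⟩ := (repClique_isMaxClique i).nontrivial hX.connected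
  have hadj := (repClique_isMaxClique i).1 ha hb hab
  obtain ⟨k, hk, -⟩ := hc.adj_iff.1 hadj
  exact ⟨k, fun x y hxy hi => label_eq_of_coord hX hc hadj hxy
    (by rwa [coord_of_mem ha, coord_of_mem hb]) hi hk⟩

variable {lab : ParallelClass hX → J}

theorem label_ne_of_coord_ne (hc : IsCoordEmbedding X c)
    (hlab : ∀ i x y, X.Adj x y → coord hX x i ≠ coord hX y i → c x (lab i) ≠ c y (lab i))
    {i : ParallelClass hX} {x y : V} (h : coord hX x i ≠ coord hX y i) :
    c x (lab i) ≠ c y (lab i) := by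
  obtain ⟨u, v, huv, hne, hd⟩ := exists_crossing hX.connected (fun w => coord hX w i) h
  have hk := hlab i u v huv hne
  obtain ⟨h1, h2⟩ := hc.eq_of_crossing hX.connected huv hd hk
  rwa [← h1, ← h2]

/-- Take vertices separated by both `i` and `j`. On a geodesic between them the edge `uv` crossing
`i` already uses up the only change of the label, yet `j` must be crossed before `u` or after `v`
and would change it again. -/
theorem label_injective [Nontrivial V] (hc : IsCoordEmbedding X c)
    (hlab : ∀ i x y, X.Adj x y → coord hX x i ≠ coord hX y i → c x (lab i) ≠ c y (lab i)) :
    Function.Injective lab := by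
  intro i j hk
  by_contra hij
  obtain ⟨x, y, hxi, hxj⟩ : ∃ x y, coord hX x i ≠ coord hX y i ∧ coord hX x j ≠ coord hX y j := by
    obtain ⟨s₀, hs₀⟩ := (repClique_isMaxClique i).nonempty
    obtain ⟨t₀, ht₀⟩ := (repClique_isMaxClique j).nonempty
    obtain ⟨s, hs, hs'⟩ :=
      ((repClique_isMaxClique i).nontrivial hX.connected).exists_ne (coord hX t₀ i)
    obtain ⟨t, ht, ht'⟩ :=
      ((repClique_isMaxClique j).nontrivial hX.connected).exists_ne (coord hX s₀ j)
    refine ⟨s, t, ?_, ?_⟩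
    · rw [coord_of_mem hs, coord_eq_of_mem_repClique (Ne.symm hij) ht ht₀]
      exact hs'
    · rw [coord_of_mem ht, coord_eq_of_mem_repClique hij hs hs₀]
      exact ht'.symm
  obtain ⟨u, v, huv, hne, hd⟩ := exists_crossing hX.connected (fun w => coord hX w i) hxi
  obtain ⟨h1, h2⟩ := hc.eq_of_crossing hX.connected huv hd (hlab i u v huv hne)
  rw [hk] at h1 h2
  have huvj : coord hX u j = coord hX v j := by
    by_contra h
    exact hij ((coord_isCoordEmbedding hX).label_unique huv hne h)
  by_cases hu : coord hX u j = coord hX x j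
  · exact label_ne_of_coord_ne hc hlab (x := v) (y := y) (by rwa [← huvj, hu]) h2
  · exact label_ne_of_coord_ne hc hlab hu h1

/-- The coordinates of an isometric embedding in a Hamming graph are determined by the coordinates
of the paraclique graph. -/
theorem eq_of_coord_eq [Nontrivial V] (hc : IsCoordEmbedding X c)
    (hlab : ∀ i x y, X.Adj x y → coord hX x i ≠ coord hX y i → c x (lab i) ≠ c y (lab i))
    {k : J} {x y : V} (h : ∀ i, lab i = k → coord hX x i = coord hX y i) : c x k = c y k := by
  by_contra hne
  obtain ⟨u, v, huv, hne', hd⟩ := exists_crossing hX.connected (fun w => c w k) hne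
  obtain ⟨i, hi, -⟩ := (coord_isCoordEmbedding hX).adj_iff.1 huv
  have hik : lab i = k := hc.label_unique huv (hlab i u v huv hi) hne'
  obtain ⟨h1, h2⟩ := (coord_isCoordEmbedding hX).eq_of_crossing hX.connected huv hd hi
  exact hi (h1.trans ((h i hik).trans h2.symm))

/-- The extension to the product of cliques of an isometric embedding in a Hamming graph. -/
noncomputable def extension (c : V → ∀ k, L k) (lab : ParallelClass hX → J) (x₀ : V)
    (f : ParallelClass hX → V) : ∀ k, L k :=
  -- At `lab i` the value is read at the vertex `f i`. At indices that label no class `c` is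
  -- constant on `X`, so any default vertex would do.
  fun k => c (Function.extend lab f (fun _ => x₀) k) k

variable {x₀ : V}

theorem extension_label (hlab : Function.Injective lab) (f : ParallelClass hX → V)
    (i : ParallelClass hX) : extension c lab x₀ f (lab i) = c (f i) (lab i) := by
  rw [extension, hlab.extend_apply]

theorem extension_of_notMem {k : J} (hk : ¬∃ i, lab i = k) (f : ParallelClass hX → V) :
    extension c lab x₀ f k = c x₀ k := by
  rw [extension, Function.extend_apply' _ _ _ hk]

theorem extension_coord [Nontrivial V] (hc : IsCoordEmbedding X c)
    (hlab : ∀ i x y, X.Adj x y → coord hX x i ≠ coord hX y i → c x (lab i) ≠ c y (lab i)) (x : V) :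
    extension c lab x₀ (coord hX x) = c x := by
  have hinj := label_injective hc hlab
  funext k
  by_cases hk : ∃ i, lab i = k
  · obtain ⟨i, rfl⟩ := hk
    rw [extension_label hinj]
    refine eq_of_coord_eq hc hlab fun j hj => ?_
    rw [hinj hj, coord_of_mem (coord_mem x i)]
  · rw [extension_of_notMem hk]
    exact eq_of_coord_eq hc hlab fun i hi => absurd ⟨i, hi⟩ hk

theorem extension_label_eq_iff [Nontrivial V] (hc : IsCoordEmbedding X c)
    (hlab : ∀ i x y, X.Adj x y → coord hX x i ≠ coord hX y i → c x (lab i) ≠ c y (lab i))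
    {f g : ParallelClass hX → V} (hf : ∀ i, f i ∈ repClique i) (hg : ∀ i, g i ∈ repClique i)
    (i : ParallelClass hX) :
    extension c lab x₀ f (lab i) = extension c lab x₀ g (lab i) ↔ f i = g i := by
  have hinj := label_injective hc hlab
  rw [extension_label hinj, extension_label hinj]
  refine ⟨fun h => ?_, fun h => by rw [h]⟩
  by_contra hne
  refine label_ne_of_coord_ne hc hlab (i := i) (x := f i) (y := g i) ?_ h
  rwa [coord_of_mem (hf i), coord_of_mem (hg i)]

theorem extension_encard [Nontrivial V] (hc : IsCoordEmbedding X c)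
    (hlab : ∀ i x y, X.Adj x y → coord hX x i ≠ coord hX y i → c x (lab i) ≠ c y (lab i))
    {f g : ParallelClass hX → V} (hf : ∀ i, f i ∈ repClique i) (hg : ∀ i, g i ∈ repClique i) :
    {k | extension c lab x₀ f k ≠ extension c lab x₀ g k}.encard = {i | f i ≠ g i}.encard := by
  rw [← (label_injective hc hlab).encard_image]
  congr 1
  ext k
  simp only [Set.mem_image, Set.mem_ofPred_eq]
  constructor
  · intro h
    by_cases hk : ∃ i, lab i = k
    · obtain ⟨i, rfl⟩ := hk
      exact ⟨i, fun h' => h ((extension_label_eq_iff hc hlab hf hg i).2 h'), rfl⟩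
    · rw [extension_of_notMem hk, extension_of_notMem hk] at h
      exact absurd rfl h
  · rintro ⟨i, hi, rfl⟩ h
    exact hi ((extension_label_eq_iff hc hlab hf hg i).1 h)

theorem extension_majority [Nontrivial V] (hc : IsCoordEmbedding X c)
    (hlab : ∀ i x y, X.Adj x y → coord hX x i ≠ coord hX y i → c x (lab i) ≠ c y (lab i))
    {f g h : ParallelClass hX → V} (hg : ∀ i, g i ∈ repClique i)
    (hh : ∀ i, h i ∈ repClique i) :
    extension c lab x₀ (majority f g h)
      = majority (extension c lab x₀ f) (extension c lab x₀ g) (extension c lab x₀ h) := by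
  have hinj := label_injective hc hlab
  funext k
  by_cases hk : ∃ i, lab i = k
  · obtain ⟨i, rfl⟩ := hk
    by_cases hgh : g i = h i
    · refine Eq.symm (majority_eq_of_right ?_ ?_)
      · rw [extension_label hinj, extension_label hinj, majority, if_pos hgh]
      · rw [extension_label hinj, extension_label hinj, majority, if_pos hgh, hgh]
    · have hgh' := mt (extension_label_eq_iff (x₀ := x₀) hc hlab hg hh i).1 hgh
      rw [majority, if_neg hgh', extension_label hinj, extension_label hinj, majority, if_neg hgh]
  · rw [extension_of_notMem hk]
    refine (majority_eq_of_left ?_ (.inl ?_)).symm <;> exact extension_of_notMem hk _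

theorem exists_extension [Nontrivial V] (hX : IsParaclique X) (x₀ : V) {U : Type v}
    {Q : SimpleGraph U} {η : V → U} (hQ : IsQuasiMedian Q) (hη : IsIsometricEmbedding X Q η) :
    ∃ ξ : Hull hX x₀ → U, IsIsometricEmbedding (hullGraph hX x₀) Q ξ ∧
      η = ξ ∘ toHull hX x₀ := by
  obtain ⟨J, L, o, e, r, he, hr, hre⟩ := hQ
  have hH := hammingGraph_connected L o
  have hQd := dist_eq_of_retraction hH he hr hre
  have hc : IsCoordEmbedding X fun x => (e (η x)).1 := fun x y => by
    rw [hammingGraph_isCoordEmbedding L o, hQd, hη]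
  choose lab hlab using exists_label hX hc
  have hmem : ∀ f, IsCoherent hX f → {i | f i ≠ coord hX x₀ i}.Finite →
      ∃ q, (e q).1 = extension (fun x => (e (η x)).1) lab x₀ f := by
    intro f hf hfin
    -- The families whose extension lies in the retract contain the coordinates of `X` and are
    -- closed under majorities, while coherence supplies the agreement on pairs.
    let A : Set (ParallelClass hX → V) := {g | (∀ i, g i ∈ repClique i) ∧
      {i | g i ≠ coord hX x₀ i}.Finite ∧
      ∃ q, (e q).1 = extension (fun x => (e (η x)).1) lab x₀ g}
    have hcoord : ∀ x, coord hX x ∈ A := fun x =>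
      ⟨coord_mem x, coord_finite_ne x x₀, η x, (extension_coord hc hlab x).symm⟩
    refine (mem_of_majority_closed (A := A) ?_ ?_ ⟨_, hcoord x₀⟩ ?_).2.2
    · rintro g₁ ⟨h₁, h₁', q₁, hq₁⟩ g₂ ⟨h₂, h₂', q₂, hq₂⟩ g₃ ⟨h₃, h₃', q₃, hq₃⟩
      refine ⟨fun i => ?_, (h₁'.union h₂').subset fun i hi => ?_, ?_⟩
      · unfold majority
        split_ifs
        exacts [h₂ i, h₁ i]
      · by_contra h
        simp only [Set.mem_union, Set.mem_ofPred_eq, not_or, not_not] at h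
        exact hi (majority_eq_of_left h.1 (.inl h.2))
      · rw [extension_majority hc hlab h₂ h₃, ← hq₁, ← hq₂, ← hq₃]
        exact exists_eq_majority he hr hre q₁ q₂ q₃
    · rintro g ⟨-, hg, -⟩
      exact finite_ne ⟨g, hg⟩ ⟨f, hfin⟩
    · intro i j
      obtain ⟨x, hxi, hxj⟩ := hf i j
      exact ⟨_, hcoord x, hxi, hxj⟩
  choose ξ hξ using fun f : Hull hX x₀ => hmem f.1.1 f.2 f.1.2
  have heinj : Function.Injective e := Function.LeftInverse.injective hre
  refine ⟨ξ, fun f g => ?_, funext fun x => heinj (Subtype.ext ?_)⟩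
  · rw [← hQd, ← ENat.natCast_inj, ← hammingGraph_isCoordEmbedding L o,
      ← hullGraph_isCoordEmbedding hX x₀, hξ, hξ]
    exact extension_encard hc hlab f.2.mem g.2.mem
  · rw [Function.comp_apply, hξ]
    exact (extension_coord hc hlab x).symm

end Universal

end Paraclique

theorem mainTheorem10 {V : Type u} (X : SimpleGraph V) (hX : Paraclique.IsParaclique X) :
    ∃ (W : Type u) (M : SimpleGraph W) (ι : V → W),
      Paraclique.IsQuasiMedian M ∧
      Paraclique.IsIsometricEmbedding X M ι ∧
      (∀ (U : Type v) (Q : SimpleGraph U) (η : V → U),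
        Paraclique.IsQuasiMedian Q → Paraclique.IsIsometricEmbedding X Q η →
        ∃ ξ : W → U, Paraclique.IsIsometricEmbedding M Q ξ ∧ η = ξ ∘ ι) ∧
      (∀ C : Set V, Paraclique.IsMaxClique X C → Paraclique.IsMaxClique M (ι '' C)) ∧
      (∀ D : Set W, Paraclique.IsMaxClique M D →
        ∃ C : Set V, Paraclique.IsMaxClique X C ∧ Paraclique.Parallel M D (ι '' C)) ∧
      (∀ C₁ C₂ : Set V, Paraclique.IsMaxClique X C₁ → Paraclique.IsMaxClique X C₂ →
        (Paraclique.Parallel M (ι '' C₁) (ι '' C₂) ↔ Paraclique.Parallel X C₁ C₂)) ∧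
      (∀ C₁ C₂ : Set V, Paraclique.IsMaxClique X C₁ → Paraclique.IsMaxClique X C₂ →
        (Paraclique.Transverse M (Paraclique.hyperplane M (ι '' C₁))
            (Paraclique.hyperplane M (ι '' C₂)) ↔
          Paraclique.Transverse X (Paraclique.hyperplane X C₁)
            (Paraclique.hyperplane X C₂))) := by
  obtain ⟨x₀⟩ := hX.connected.nonempty
  refine ⟨_, Paraclique.hullGraph hX x₀, Paraclique.toHull hX x₀,
    Paraclique.hullGraph_isQuasiMedian hX x₀, Paraclique.toHull_isIsometricEmbedding hX x₀,
    fun U Q η hQ hη => ?_, fun C hC => Paraclique.toHull_image_isMaxClique hC,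
    fun D hD => Paraclique.exists_parallel_toHull_image hD,
    fun C₁ C₂ h₁ h₂ => Paraclique.parallel_toHull_image_iff h₁ h₂,
    fun C₁ C₂ h₁ h₂ => Paraclique.transverse_toHull_image_iff h₁ h₂⟩
  -- A one-vertex graph has no edges to define labels, but there the hull is a point.
  rcases subsingleton_or_nontrivial V with hV | hV
  · refine ⟨fun _ => η x₀, fun f g => ?_, funext fun x => congrArg η (Subsingleton.elim _ _)⟩
    rw [Subsingleton.elim f g, SimpleGraph.dist_self, SimpleGraph.dist_self]
  · exact Paraclique.exists_extension hX x₀ hQ hη
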